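/- Fix an integer $n$. Let $\mathrm{Riem}_n^{\mathrm{or}}$ (resp. $\mathrm{Lrtz}_n^{\mathrm{or}}$) be the site of oriented Riemannian (resp. Lorentzian, signature $(-,+,\dots,+)$) smooth $n$-manifolds, with isometric orientation-preserving open embeddings as morphisms and jointly surjective families as covers; let $\star$ be the Hodge star. Let $\mathsf T$ be the category of dg manifolds $\mathcal M$ (a smooth manifold with a sheaf of dg algebras whose underlying graded algebra consists of the sections of the graded symmetric algebra of a bounded graded vector bundle in negative degrees). Localized at quasi-isomorphisms it presents derived manifolds; a family of open embeddings is a cover of $\mathcal M$ if its images cover the underlying space $|\mathcal M|$ (the zero locus of the differential). A derived stack is a functor from derived manifolds to the $\infty$-category of spaces satisfying descent; a derived abelian group stack is an abelian group object in derived stacks. For $0\le p\le n-2$ and $\kappa,e\in\mathbb R\setminus\{0\}$ let $\mathrm{Mxw}^\circ_{p,n}\langle\kappa,e\rangle$ be the presheaf of cochain complexes $$ \begin{array}{ccccccccc} \mathbb Z & \xrightarrow{\;1\;} & \Omega^0 & \xrightarrow{d} & \cdots & \xrightarrow{d} & \Omega^p & & \\ & & & & & & & \searrow^{\star d} & \\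 & & & & & & & & \Omega^{n-p-1}\\ & & & & & & & \nearrow_{-\kappa d} & \\ \mathbb Z & \xrightarrow{\;e\;} & \Omega^0 & \xrightarrow{d} & \cdots & \xrightarrow{d} & \Omega^{n-p-2} & & \end{array} $$ with $\Omega^p$ and $\Omega^{n-p-2}$ in degree $0$. On a pair $(M,\mathcal M)$ of a spacetime and a dg manifold, $\Omega^k$ stands for the sections over $M\times\mathcal M$ of the pull-back of $\Lambda^kT^*M$ (with $d$ and $\star$ in the direction of $M$, and with the internal differential of $\mathcal M$), $\mathbb Z$ stands for locally constant integer-valued functions, and the total complex is taken. Let $\mathbb{M}\mathrm{xw}^\circ_{p,n}\langle\kappa,e\rangle$ be the sheaf on $\mathrm{Riem}_n^{\mathrm{or}}$ (resp. $\mathrm{Lrtz}_n^{\mathrm{or}}$) valued in derived (abelian group) stacks that it presents through the smart truncation to nonpositive degrees, the Dold--Kan correspondence and sheafification; this is the charge-discretized $p$-form Maxwell theory. **Theorem (abelian duality).** For all $n$, all $p$ with $0\le p\le n-2$ and all nonzero real $\kappa,e$ there is an isomorphism $$\mathbb{M}\mathrm{xw}^\circ_{p,n}\langle\kappa,e\rangle\;\xrightarrow{\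 \cong\ }\;\mathbb{M}\mathrm{xw}^\circ_{n-p-2,n}\langle 1/\kappa,1/e\rangle$$ of sheaves on $\mathrm{Riem}_n^{\mathrm{or}}$ valued in derived stacks, and likewise on $\mathrm{Lrtz}_n^{\mathrm{or}}$; there is also such an isomorphism of sheaves valued in derived abelian group stacks. Already the presenting presheaves of cochain complexes are isomorphic, $\mathrm{Mxw}^\circ_{p,n}\langle\kappa,e\rangle\cong\mathrm{Mxw}^\circ_{n-p-2,n}\langle 1/\kappa,1/e\rangle$: for a suitable sign $\sigma\in\{1,-1\}$, an isomorphism is given by interchanging the two rows, multiplying the forms of the bottom row by $1/e$ and those of the top row by $\sigma/e$ (and the corresponding copies of $\mathbb Z$ by $1$ and $\sigma$), and applying $-\tfrac1{\kappa e}\star$ to $\Omega^{n-p-1}$. -/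

import Mathlib

open scoped Manifold ContDiff TensorProduct
open CategoryTheory

noncomputable section

namespace AbelianDuality

/-! ### Local parametrizations, tensors in local coordinates -/

/-- Euclidean space of dimension `n`. -/
abbrev Euc (n : ℕ) : Type := EuclideanSpace ℝ (Fin n)

/-- Alternating `k`-forms on `ℝⁿ`. -/
abbrev Alt (n k : ℕ) : Type := Euc n [⋀^Fin k]→L[ℝ] ℝ

/-- The standard basis vectors of `ℝⁿ`. -/
def stdVec {n : ℕ} (i : Fin n) : Euc n := EuclideanSpace.single i 1

/-- A local parametrization (inverse of a chart of the maximal smooth atlas) of an `n`-manifold: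
a diffeomorphism from an open set of `ℝⁿ` onto an open set of `M`. Only the values of `toFun`
on `dom` matter. -/
structure Patch (n : ℕ) (M : Type) [TopologicalSpace M] [ChartedSpace (Euc n) M] where
  toFun : Euc n → M
  dom : Set (Euc n)
  isOpen_dom : IsOpen dom
  injOn : Set.InjOn toFun dom
  isLocalDiffeomorphOn : IsLocalDiffeomorphOn (𝓡 n) (𝓡 n) ∞ toFun dom

section Patch

variable {n : ℕ} {M N : Type} [TopologicalSpace M] [ChartedSpace (Euc n) M]
  [TopologicalSpace N] [ChartedSpace (Euc n) N]

/-- The push-forward of a local parametrization along an open embedding. -/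
def Patch.push (c : Patch n M) (f : M → N) (hf : Function.Injective f)
    (hf' : IsLocalDiffeomorph (𝓡 n) (𝓡 n) ∞ f) : Patch n N where
  toFun := f ∘ c.toFun
  dom := c.dom
  isOpen_dom := c.isOpen_dom
  injOn := fun _ hx _ hy h => c.injOn hx hy (hf h)
  isLocalDiffeomorphOn := fun y => IsLocalDiffeomorphAt.comp (hf := c.isLocalDiffeomorphOn y) (hg := hf' _)

/-- `h` is the coordinate change from `c'` to `c`; the image of `c'` lies in that of `c`. -/
structure IsTransition (c' c : Patch n M) (h : Euc n → Euc n) : Prop where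
  contDiffOn : ContDiffOn ℝ ∞ h c'.dom
  mapsTo : Set.MapsTo h c'.dom c.dom
  comp_eq : ∀ y ∈ c'.dom, c.toFun (h y) = c'.toFun y

theorem IsTransition.push {c' c : Patch n M} {h : Euc n → Euc n} (H : IsTransition c' c h)
    (f : M → N) (hf : Function.Injective f) (hf' : IsLocalDiffeomorph (𝓡 n) (𝓡 n) ∞ f) :
    IsTransition (c'.push f hf hf') (c.push f hf hf') h :=
  ⟨H.contDiffOn, H.mapsTo, fun y hy => congrArg f (H.comp_eq y hy)⟩

theorem IsTransition.contDiffAt {c' c : Patch n M} {h : Euc n → Euc n} (H : IsTransition c' c h)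
    {y : Euc n} (hy : y ∈ c'.dom) : ContDiffAt ℝ ∞ h y :=
  H.contDiffOn.contDiffAt (c'.isOpen_dom.mem_nhds hy)

theorem Patch.continuousOn (c : Patch n M) : ContinuousOn c.toFun c.dom := fun y hy =>
  ((c.isLocalDiffeomorphOn ⟨y, hy⟩).contMDiffAt).continuousAt.continuousWithinAt

end Patch

/-! ### Differential forms with smooth parameters -/

/-- The ring of smooth functions on an `N`-manifold. -/
abbrev Sm (N : ℕ) (X : Type) [TopologicalSpace X] [ChartedSpace (Euc N) X] : Type :=
  ContMDiffMap (𝓡 N) 𝓘(ℝ, ℝ) X ℝ ∞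

section Forms

variable (n : ℕ) (M : Type) [TopologicalSpace M] [ChartedSpace (Euc n) M]
  (N : ℕ) (X : Type) [TopologicalSpace X] [ChartedSpace (Euc N) X]

/-- Smooth `k`-forms on `M` depending smoothly on a parameter in `X`, i.e. smooth sections of the
pullback of `Λᵏ T^*M` to `M × X`. Such a form is the compatible family of its expressions in all
local parametrizations of `M` (extended by zero outside the domain of the parametrization). -/
def formSubgroup (k : ℕ) : AddSubgroup (Patch n M → Euc n → X → Alt n k) where
  carrier := {α |
    (∀ c, ContMDiffOn ((𝓡 n).prod (𝓡 N)) 𝓘(ℝ, Alt n k) ∞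
      (fun z : Euc n × X => α c z.1 z.2) (c.dom ×ˢ Set.univ)) ∧
    (∀ c, ∀ y ∉ c.dom, ∀ x, α c y x = 0) ∧
    ∀ c' c h, IsTransition c' c h → ∀ y ∈ c'.dom, ∀ x,
      α c' y x = (α c (h y) x).compContinuousLinearMap (fderiv ℝ h y)}
  zero_mem' := ⟨fun _ => contMDiffOn_const, fun _ _ _ _ => rfl, fun _ _ _ _ _ _ _ => rfl⟩
  add_mem' {a b} ha hb := by
    refine ⟨fun c => (ha.1 c).add (hb.1 c), fun c y hy x => ?_, fun c' c h H y hy x => ?_⟩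
    · simp [ha.2.1 c y hy x, hb.2.1 c y hy x]
    · simp only [Pi.add_apply, ha.2.2 c' c h H y hy x, hb.2.2 c' c h H y hy x]
      rfl
  neg_mem' {a} ha := by
    refine ⟨fun c => (ha.1 c).neg, fun c y hy x => ?_, fun c' c h H y hy x => ?_⟩
    · simp [ha.2.1 c y hy x]
    · simp only [Pi.neg_apply, ha.2.2 c' c h H y hy x]
      rfl

/-- The group of `k`-forms on `M` in smooth families over `X`. -/
def Form (k : ℕ) : Type := ↥(formSubgroup n M N X k)

instance (k : ℕ) : AddCommGroup (Form n M N X k) :=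
  inferInstanceAs (AddCommGroup ↥(formSubgroup n M N X k))

variable {n M N X}

theorem Form.smooth {k : ℕ} (α : Form n M N X k) (c : Patch n M) :
    ContMDiffOn ((𝓡 n).prod (𝓡 N)) 𝓘(ℝ, Alt n k) ∞
      (fun z : Euc n × X => α.1 c z.1 z.2) (c.dom ×ˢ Set.univ) := α.2.1 c

theorem Form.off {k : ℕ} (α : Form n M N X k) (c : Patch n M) {y : Euc n}
    (hy : y ∉ c.dom) (x : X) : α.1 c y x = 0 := α.2.2.1 c y hy x

theorem Form.compat {k : ℕ} (α : Form n M N X k) {c' c : Patch n M}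
    {h : Euc n → Euc n} (H : IsTransition c' c h) {y : Euc n} (hy : y ∈ c'.dom) (x : X) :
    α.1 c' y x = (α.1 c (h y) x).compContinuousLinearMap (fderiv ℝ h y) := α.2.2.2 c' c h H y hy x

theorem Form.ext {k : ℕ} {α η : Form n M N X k}
    (h : ∀ c, ∀ y ∈ c.dom, ∀ x, α.1 c y x = η.1 c y x) : α = η := by
  apply Subtype.ext
  funext c y x
  by_cases hy : y ∈ c.dom
  · exact h c y hy x
  · rw [α.off c hy, η.off c hy]

theorem Form.contDiffAt {k : ℕ} (α : Form n M N X k) (c : Patch n M) {y : Euc n}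
    (hy : y ∈ c.dom) (x : X) : ContDiffAt ℝ ∞ (fun y' => α.1 c y' x) y := by
  have h1 := (α.smooth c).contMDiffAt (x := (y, x))
    ((c.isOpen_dom.prod isOpen_univ).mem_nhds ⟨hy, trivial⟩)
  have h2 : ContMDiffAt (𝓡 n) ((𝓡 n).prod (𝓡 N)) ∞ (fun y' : Euc n => (y', x)) y :=
    contMDiffAt_id.prodMk contMDiffAt_const
  exact (h1.comp y h2).contDiffAt

instance {k : ℕ} : SMul (Sm N X) (Form n M N X k) where
  smul r α := ⟨fun c y x => r x • α.1 c y x, by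
    refine ⟨fun c => ?_, fun c y hy x => by simp [α.off c hy], fun c' c h H y hy x => ?_⟩
    · exact ContMDiffOn.smul (r.contMDiff.comp contMDiff_snd).contMDiffOn (α.smooth c)
    · simp only [α.compat H hy]
      rfl⟩

theorem Form.smul_apply {k : ℕ} (r : Sm N X) (α : Form n M N X k) (c : Patch n M)
    (y : Euc n) (x : X) : (r • α).1 c y x = r x • α.1 c y x := rfl

theorem Form.add_apply {k : ℕ} (α η : Form n M N X k) (c : Patch n M)
    (y : Euc n) (x : X) : (α + η).1 c y x = α.1 c y x + η.1 c y x := rfl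

theorem Form.zero_apply {k : ℕ} (c : Patch n M) (y : Euc n) (x : X) :
    (0 : Form n M N X k).1 c y x = 0 := rfl

instance {k : ℕ} : Module (Sm N X) (Form n M N X k) where
  one_smul α := Form.ext fun c y _ x => by simp [Form.smul_apply]
  mul_smul r s α := Form.ext fun c y _ x => by simp [Form.smul_apply, mul_smul]
  smul_zero r := Form.ext fun c y _ x => smul_zero (r x)
  smul_add r α η := Form.ext fun c y _ x => smul_add (r x) _ _
  add_smul r s α := Form.ext fun c y _ x => by simp [Form.smul_apply, Form.add_apply, add_smul]
  zero_smul α := Form.ext fun c y _ x => zero_smul ℝ (α.1 c y x)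

/-! ### The exterior derivative along `M` -/

theorem two_le_infty : minSmoothness ℝ 2 ≤ (∞ : WithTop ℕ∞) := by
  rw [minSmoothness_of_isRCLikeNormedField]
  exact WithTop.coe_le_coe.2 le_top

theorem contMDiffAt_fderiv_fst {F : Type} [NormedAddCommGroup F] [NormedSpace ℝ F]
    [IsManifold (𝓡 N) ∞ X]
    {f : Euc n → X → F} {y : Euc n} {x : X}
    (hf : ContMDiffAt ((𝓡 n).prod (𝓡 N)) 𝓘(ℝ, F) ∞ (fun z : Euc n × X => f z.1 z.2) (y, x)) :
    ContMDiffAt ((𝓡 n).prod (𝓡 N)) 𝓘(ℝ, Euc n →L[ℝ] F) ∞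
      (fun z : Euc n × X => fderiv ℝ (fun y' => f y' z.2) z.1) (y, x) := by
  have h := ContMDiffAt.mfderiv (I := 𝓡 n) (I' := 𝓘(ℝ, F)) (J := (𝓡 n).prod (𝓡 N)) (n := ∞) (m := ∞)
    (x₀ := (y, x))
    (fun (z : Euc n × X) (y' : Euc n) => f y' z.2) (fun z => z.1)
    (by
      have hg : ContMDiffAt (((𝓡 n).prod (𝓡 N)).prod (𝓡 n)) ((𝓡 n).prod (𝓡 N)) ∞
          (fun w : (Euc n × X) × Euc n => (w.2, w.1.2)) ((y, x), y) :=
        contMDiffAt_snd.prodMk (contMDiffAt_snd.comp _ contMDiffAt_fst)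
      exact ContMDiffAt.comp (g := fun z : Euc n × X => f z.1 z.2) ((y, x), y) hf hg)
    contMDiffAt_fst (by simp)
  simpa [inTangentCoordinates_model_space, mfderiv_eq_fderiv] using h

open Classical in
/-- The exterior derivative in the direction of `M`. -/
def Form.dFun [IsManifold (𝓡 N) ∞ X] {k : ℕ} (α : Form n M N X k) : Form n M N X (k + 1) :=
  ⟨fun c y x => if y ∈ c.dom then extDeriv (fun y' => α.1 c y' x) y else 0, by
    refine ⟨fun c => ?_, fun c y hy x => if_neg hy, fun c' c h H y hy x => ?_⟩
    · have : ContMDiffOn ((𝓡 n).prod (𝓡 N)) 𝓘(ℝ, Alt n (k + 1)) ∞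
          (fun z : Euc n × X => extDeriv (fun y' => α.1 c y' z.2) z.1) (c.dom ×ˢ Set.univ) := by
        intro z hz
        have h1 := (α.smooth c).contMDiffAt (x := z)
          ((c.isOpen_dom.prod isOpen_univ).mem_nhds hz)
        have h2 := contMDiffAt_fderiv_fst (f := α.1 c) (y := z.1) (x := z.2) h1
        exact (ContMDiffAt.comp z
          (ContinuousAlternatingMap.alternatizeUncurryFinCLM ℝ (Euc n) ℝ).contMDiff.contMDiffAt
            h2).contMDiffWithinAt
      exact this.congr fun z hz => if_pos hz.1
    · beta_reduce
      rw [if_pos hy, if_pos (H.mapsTo hy), ← extDeriv_pullback (r := ∞) ((α.contDiffAt c (H.mapsTo hy) x).differentiableAt (by simp))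
        (H.contDiffAt hy) two_le_infty]
      refine Filter.EventuallyEq.extDeriv_eq ?_
      filter_upwards [c'.isOpen_dom.mem_nhds hy] with y' hy'
      exact α.compat H hy' x⟩
theorem Form.dFun_apply [IsManifold (𝓡 N) ∞ X] {k : ℕ} (α : Form n M N X k) (c : Patch n M) {y : Euc n}
    (hy : y ∈ c.dom) (x : X) : (Form.dFun α).1 c y x = extDeriv (fun y' => α.1 c y' x) y :=
  if_pos hy

/-- The exterior derivative as a map that is linear over the functions of the parameters. -/
def Form.d [IsManifold (𝓡 N) ∞ X] (k : ℕ) : Form n M N X k →ₗ[Sm N X] Form n M N X (k + 1) where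
  toFun := Form.dFun
  map_add' α η := Form.ext fun c y hy x => by
    rw [Form.add_apply, Form.dFun_apply _ c hy, Form.dFun_apply _ c hy, Form.dFun_apply _ c hy]
    exact extDeriv_fun_add ((α.contDiffAt c hy x).differentiableAt (by simp))
      ((η.contDiffAt c hy x).differentiableAt (by simp))
  map_smul' r α := Form.ext fun c y hy x => by
    rw [RingHom.id_apply, Form.smul_apply, Form.dFun_apply _ c hy, Form.dFun_apply _ c hy]
    exact extDeriv_fun_smul (r x) _

theorem Form.d_apply [IsManifold (𝓡 N) ∞ X] {k : ℕ} (α : Form n M N X k) (c : Patch n M) {y : Euc n}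
    (hy : y ∈ c.dom) (x : X) : (Form.d k α).1 c y x = extDeriv (fun y' => α.1 c y' x) y :=
  if_pos hy

theorem Form.d_d [IsManifold (𝓡 N) ∞ X] {k : ℕ} (α : Form n M N X k) :
    Form.d (k + 1) (Form.d k α) = 0 := Form.ext fun c y hy x => by
  rw [Form.d_apply _ c hy]
  have : (fun y' => (Form.d k α).1 c y' x) =ᶠ[nhds y] extDeriv (fun y' => α.1 c y' x) := by
    filter_upwards [c.isOpen_dom.mem_nhds hy] with y' hy'
    exact Form.d_apply α c hy' x
  rw [this.extDeriv_eq]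
  exact extDeriv_extDeriv_apply (r := ∞) (α.contDiffAt c hy x) two_le_infty

open Classical in
/-- The locally constant integer-valued function `z`, multiplied by the real constant `m`,
as a `0`-form. -/
def Form.ofIntFun (m : ℝ) (z : LocallyConstant (M × X) ℤ) : Form n M N X 0 :=
  ⟨fun c y x => if y ∈ c.dom then
      ContinuousAlternatingMap.constOfIsEmpty ℝ (Euc n) (Fin 0) (m * (z (c.toFun y, x) : ℝ)) else 0, by
    refine ⟨fun c => ?_, fun c y hy x => if_neg hy, fun c' c h H y hy x => ?_⟩
    · have : ContMDiffOn ((𝓡 n).prod (𝓡 N)) 𝓘(ℝ, Alt n 0) ∞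
          (fun w : Euc n × X => (ContinuousAlternatingMap.constOfIsEmpty ℝ (Euc n) (Fin 0)
            (m * (z (c.toFun w.1, w.2) : ℝ)) : Alt n 0)) (c.dom ×ˢ Set.univ) := by
        intro w hw
        have hc : ContinuousAt (fun v : Euc n × X => (c.toFun v.1, v.2)) w :=
          (ContinuousAt.comp (c.continuousOn.continuousAt (c.isOpen_dom.mem_nhds hw.1))
            continuousAt_fst).prodMk continuousAt_snd
        have hz : ∀ᶠ v in nhds w, z (c.toFun v.1, v.2) = z (c.toFun w.1, w.2) :=
          hc.eventually (z.isLocallyConstant.eventually_eq _)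
        refine ContMDiffAt.contMDiffWithinAt ?_
        refine (contMDiffAt_const (c := (ContinuousAlternatingMap.constOfIsEmpty ℝ (Euc n) (Fin 0)
            (m * (z (c.toFun w.1, w.2) : ℝ)) : Alt n 0))).congr_of_eventuallyEq ?_
        filter_upwards [hz] with v hv
        rw [hv]
      exact this.congr fun w hw => if_pos hw.1
    · beta_reduce
      rw [if_pos hy, if_pos (H.mapsTo hy), H.comp_eq y hy]
      rfl⟩
theorem Form.ofIntFun_apply (m : ℝ) (z : LocallyConstant (M × X) ℤ) (c : Patch n M) {y : Euc n}
    (hy : y ∈ c.dom) (x : X) : (Form.ofIntFun (n := n) (N := N) m z).1 c y x =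
      ContinuousAlternatingMap.constOfIsEmpty ℝ (Euc n) (Fin 0) (m * (z (c.toFun y, x) : ℝ)) :=
  if_pos hy

/-- The inclusion of the locally constant integer-valued functions into the `0`-forms, scaled by
the real constant `m`. -/
def Form.ofInt (m : ℝ) : LocallyConstant (M × X) ℤ →+ Form n M N X 0 where
  toFun := Form.ofIntFun m
  map_zero' := Form.ext fun c y hy x => by
    rw [Form.ofIntFun_apply _ _ c hy]
    ext; simp [Form.zero_apply]
  map_add' z w := Form.ext fun c y hy x => by
    rw [Form.add_apply, Form.ofIntFun_apply _ _ c hy, Form.ofIntFun_apply _ _ c hy,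
      Form.ofIntFun_apply _ _ c hy]
    ext; simp [mul_add]

theorem Form.ofInt_apply (m : ℝ) (z : LocallyConstant (M × X) ℤ) (c : Patch n M) {y : Euc n}
    (hy : y ∈ c.dom) (x : X) : (Form.ofInt (n := n) (N := N) m z).1 c y x =
      ContinuousAlternatingMap.constOfIsEmpty ℝ (Euc n) (Fin 0) (m * (z (c.toFun y, x) : ℝ)) :=
  if_pos hy

theorem Form.d_ofInt [IsManifold (𝓡 N) ∞ X] (m : ℝ) (z : LocallyConstant (M × X) ℤ) :
    Form.d 0 (Form.ofInt (n := n) (N := N) m z) = 0 := Form.ext fun c y hy x => by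
  rw [Form.d_apply _ c hy]
  have hc : ContinuousAt (fun v : Euc n => (c.toFun v, x)) y :=
    (c.continuousOn.continuousAt (c.isOpen_dom.mem_nhds hy)).prodMk continuousAt_const
  have hz : ∀ᶠ v in nhds y, z (c.toFun v, x) = z (c.toFun y, x) :=
    hc.eventually (z.isLocallyConstant.eventually_eq _)
  have : (fun y' => (Form.ofInt (n := n) (N := N) m z).1 c y' x) =ᶠ[nhds y]
      fun _ => ContinuousAlternatingMap.constOfIsEmpty ℝ (Euc n) (Fin 0)
        (m * (z (c.toFun y, x) : ℝ)) := by
    filter_upwards [hz, c.isOpen_dom.mem_nhds hy] with v hv hv'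
    rw [Form.ofInt_apply m z c hv', hv]
  rw [this.extDeriv_eq]
  simp only [extDeriv, fderiv_const_apply]
  exact map_zero (ContinuousAlternatingMap.alternatizeUncurryFinCLM ℝ (Euc n) ℝ)

end Forms

/-! ### Pull-back of forms along open embeddings and changes of parameters -/

section Pull

variable {n : ℕ} {M M' : Type} [TopologicalSpace M] [ChartedSpace (Euc n) M]
  [TopologicalSpace M'] [ChartedSpace (Euc n) M']
  {N N' : ℕ} {X X' : Type} [TopologicalSpace X] [ChartedSpace (Euc N) X]
  [TopologicalSpace X'] [ChartedSpace (Euc N') X']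

/-- Smooth maps between parameter manifolds. -/
abbrev SmMap (N : ℕ) (X : Type) [TopologicalSpace X] [ChartedSpace (Euc N) X]
    (N' : ℕ) (X' : Type) [TopologicalSpace X'] [ChartedSpace (Euc N') X'] : Type :=
  ContMDiffMap (𝓡 N) (𝓡 N') X X' ∞

/-- Pull-back of smooth functions. -/
def SmMap.pull (φ : SmMap N X N' X') : Sm N' X' →+* Sm N X where
  toFun r := r.comp φ
  map_one' := rfl
  map_mul' _ _ := rfl
  map_zero' := rfl
  map_add' _ _ := rfl

theorem SmMap.pull_apply (φ : SmMap N X N' X') (r : Sm N' X') (x : X) :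
    φ.pull r x = r (φ x) := rfl

/-- Pull-back of families of forms on `M'` over `X'` along an open embedding `f : M → M'` and a
smooth map `φ : X → X'`. -/
def Form.pull {k : ℕ} (f : M → M') (hf : Function.Injective f)
    (hf' : IsLocalDiffeomorph (𝓡 n) (𝓡 n) ∞ f) (φ : SmMap N X N' X') :
    Form n M' N' X' k →ₛₗ[φ.pull] Form n M N X k where
  toFun α := ⟨fun c y x => α.1 (c.push f hf hf') y (φ x), by
    refine ⟨fun c => ?_, fun c y hy x => α.off (c.push f hf hf') hy _,
      fun c' c h H y hy x => α.compat (H.push f hf hf') hy _⟩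
    have h1 := α.smooth (c.push f hf hf')
    have h2 : ContMDiff ((𝓡 n).prod (𝓡 N)) ((𝓡 n).prod (𝓡 N')) ∞
        (fun z : Euc n × X => (z.1, φ z.2)) :=
      contMDiff_fst.prodMk (φ.contMDiff.comp contMDiff_snd)
    exact h1.comp h2.contMDiffOn (fun z hz => ⟨hz.1, trivial⟩)⟩
  map_add' _ _ := rfl
  map_smul' _ _ := rfl

theorem Form.pull_apply {k : ℕ} (f : M → M') (hf : Function.Injective f)
    (hf' : IsLocalDiffeomorph (𝓡 n) (𝓡 n) ∞ f) (φ : SmMap N X N' X') (α : Form n M' N' X' k)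
    (c : Patch n M) (y : Euc n) (x : X) :
    (Form.pull f hf hf' φ α).1 c y x = α.1 (c.push f hf hf') y (φ x) := rfl

theorem Form.pull_d [IsManifold (𝓡 N) ∞ X] [IsManifold (𝓡 N') ∞ X'] {k : ℕ} (f : M → M')
    (hf : Function.Injective f)
    (hf' : IsLocalDiffeomorph (𝓡 n) (𝓡 n) ∞ f) (φ : SmMap N X N' X') (α : Form n M' N' X' k) :
    Form.pull f hf hf' φ (Form.d k α) = Form.d k (Form.pull f hf hf' φ α) :=
  Form.ext fun c y hy x => by
    rw [Form.d_apply _ c hy, Form.pull_apply, Form.d_apply _ (c.push f hf hf') hy]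
    rfl

theorem Form.pull_ofInt (m : ℝ) (f : M → M') (hf : Function.Injective f)
    (hf' : IsLocalDiffeomorph (𝓡 n) (𝓡 n) ∞ f) (φ : SmMap N X N' X')
    (z : LocallyConstant (M' × X') ℤ) (F : C(M × X, M' × X')) (hF : ∀ u, F u = (f u.1, φ u.2)) :
    Form.pull f hf hf' φ (Form.ofInt m z) = Form.ofInt m (z.comap F) :=
  Form.ext fun c y hy x => by
    rw [Form.pull_apply, Form.ofInt_apply m z (c.push f hf hf') hy, Form.ofInt_apply _ _ c hy]
    simp only [LocallyConstant.coe_comap, Function.comp_apply, hF]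
    rfl

end Pull

/-! ### The Hodge star on `ℝⁿ` -/

section Star

variable {n : ℕ}

/-- Contraction of an alternating form with `k` vectors, put in its first `k` slots. -/
def contract (m : ℕ) : (k : ℕ) → (Fin k → Euc n) → (Alt n (m + k) →L[ℝ] Alt n m)
  | 0, _ => ContinuousLinearMap.id ℝ _
  | k + 1, v => (contract m k (Fin.tail v)) ∘L
      (ContinuousLinearMap.apply ℝ (Alt n (m + k)) (v 0)) ∘L
        (ContinuousAlternatingMap.curryLeftLI (𝕜 := ℝ) (E := Euc n) (F := ℝ)
          (n := m + k)).toContinuousLinearMap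

/-- Transport of an alternating form along an equality of degrees. -/
def castDeg {a b : ℕ} (h : a = b) : Alt n a →L[ℝ] Alt n b :=
  h ▸ ContinuousLinearMap.id ℝ (Alt n a)

/-- The Hodge star of the `k`-form `η` for the metric with Gram matrix `G` and the volume form `ν`
(`m + k = n`), normalized by `α ∧ ⋆ η = ⟨α, η⟩ ν`:
`(⋆η)(w) = (1/k!) ∑_{I,J} g^{i₁j₁} ⋯ g^{iₖjₖ} η(e_{j₁}, …, e_{jₖ}) ν(e_{i₁}, …, e_{iₖ}, w)`. -/
def starAt {m k : ℕ} (h : n = m + k) (G : Matrix (Fin n) (Fin n) ℝ) (ν : Alt n n) (η : Alt n k) :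
    Alt n m :=
  ((k.factorial : ℝ)⁻¹) • ∑ I : Fin k → Fin n, ∑ J : Fin k → Fin n,
    ((∏ a, G⁻¹ (I a) (J a)) * η (fun a => stdVec (J a))) •
      contract m k (fun a => stdVec (I a)) (castDeg h ν)

theorem castDeg_comp {a b : ℕ} (h : a = b) (ν : Alt n a) (L : Euc n →L[ℝ] Euc n) :
    castDeg h (ν.compContinuousLinearMap L) = (castDeg h ν).compContinuousLinearMap L := by
  subst h; rfl

theorem contract_comp (m k : ℕ) (v : Fin k → Euc n) (ν : Alt n (m + k)) (L : Euc n →L[ℝ] Euc n) :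
    contract m k v (ν.compContinuousLinearMap L) =
      (contract m k (fun a => L (v a)) ν).compContinuousLinearMap L := by
  induction k with
  | zero => rfl
  | succ k ih =>
    have h1 := ContinuousAlternatingMap.curryLeft_compContinuousLinearMap (n := m + k) ν L (v 0)
    calc contract m (k + 1) v (ν.compContinuousLinearMap L)
        = contract m k (Fin.tail v)
            ((ContinuousAlternatingMap.compContinuousLinearMap (ι := Fin (m + k + 1)) ν L).curryLeft
              (v 0)) := rfl
      _ = _ := by
        rw [h1, ih]
        rfl

/-- Multilinearity of the contraction in the vectors. -/
theorem exists_contract_multilinear (m k : ℕ) : ∃ T : Alt n (m + k) →ₗ[ℝ]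
    MultilinearMap ℝ (fun _ : Fin k => Euc n) (Alt n m), ∀ ν v, T ν v = contract m k v ν := by
  induction k with
  | zero =>
    exact ⟨{ toFun := fun ν => MultilinearMap.constOfIsEmpty ℝ (fun _ : Fin 0 => Euc n) ν
             map_add' := fun _ _ => rfl
             map_smul' := fun _ _ => rfl }, fun _ _ => rfl⟩
  | succ k ih =>
    obtain ⟨T, hT⟩ := ih
    refine ⟨{ toFun := fun ν => LinearMap.uncurryLeft (M := fun _ : Fin (k + 1) => Euc n)
                (T ∘ₗ (ContinuousAlternatingMap.curryLeft (n := m + k) ν).toLinearMap)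
              map_add' := fun a b => ?_
              map_smul' := fun r a => ?_ }, fun ν v => ?_⟩
    · ext1 v
      have : ContinuousAlternatingMap.curryLeft (n := m + k) (a + b) =
        ContinuousAlternatingMap.curryLeft (n := m + k) a +
          ContinuousAlternatingMap.curryLeft (n := m + k) b := rfl
      simp [LinearMap.uncurryLeft_apply, this]
    · ext1 v
      have : ContinuousAlternatingMap.curryLeft (n := m + k) (r • a) =
        r • ContinuousAlternatingMap.curryLeft (n := m + k) a := rfl
      simp [LinearMap.uncurryLeft_apply, this]
    · exact hT _ _

/-- The Jacobian matrix of a linear map. -/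
def matOf (L : Euc n →L[ℝ] Euc n) : Matrix (Fin n) (Fin n) ℝ :=
  Matrix.of fun i j => L (stdVec j) i

theorem map_stdVec (L : Euc n →L[ℝ] Euc n) (j : Fin n) :
    L (stdVec j) = ∑ i, matOf L i j • stdVec i := by
  ext i
  simp [matOf, stdVec, Pi.single_apply]

theorem multilinear_expand {F : Type} [AddCommGroup F] [Module ℝ F] {k : ℕ}
    (T : MultilinearMap ℝ (fun _ : Fin k => Euc n) F) (L : Euc n →L[ℝ] Euc n) (I : Fin k → Fin n) :
    T (fun a => L (stdVec (I a))) =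
      ∑ A : Fin k → Fin n, (∏ a, matOf L (A a) (I a)) • T (fun a => stdVec (A a)) := by
  simp_rw [map_stdVec L, T.map_sum, T.map_smul_univ]

theorem contract_expand (m k : ℕ) (ν : Alt n (m + k)) (L : Euc n →L[ℝ] Euc n) (I : Fin k → Fin n) :
    contract m k (fun a => L (stdVec (I a))) ν =
      ∑ A : Fin k → Fin n, (∏ a, matOf L (A a) (I a)) • contract m k (fun a => stdVec (A a)) ν := by
  obtain ⟨T, hT⟩ := exists_contract_multilinear (n := n) m k
  simp_rw [← hT]
  exact multilinear_expand (T ν) L I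

theorem starAt_comp {m k : ℕ} (h : n = m + k) (G : Matrix (Fin n) (Fin n) ℝ) (ν : Alt n n)
    (η : Alt n k) (L : Euc n →L[ℝ] Euc n)
    (hG : ((matOf L).transpose * G * matOf L).det ≠ 0) :
    starAt h ((matOf L).transpose * G * matOf L) (ν.compContinuousLinearMap L)
      (η.compContinuousLinearMap L) = (starAt h G ν η).compContinuousLinearMap L := by
  set P := matOf L with hP
  have hdet : IsUnit P.det := by
    rw [Matrix.det_mul, Matrix.det_mul] at hG
    exact (right_ne_zero_of_mul hG).isUnit
  have hinv : P * (P.transpose * G * P)⁻¹ * P.transpose = G⁻¹ := by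
    have hdetT : IsUnit P.transpose.det := by rwa [Matrix.det_transpose]
    rw [Matrix.mul_inv_rev, Matrix.mul_inv_rev, ← Matrix.mul_assoc, Matrix.mul_nonsing_inv _ hdet,
      Matrix.one_mul, Matrix.mul_assoc, Matrix.nonsing_inv_mul _ hdetT, Matrix.mul_one]
  have hη : ∀ J : Fin k → Fin n, (η.compContinuousLinearMap L) (fun a => stdVec (J a)) =
      ∑ A : Fin k → Fin n, (∏ a, P (A a) (J a)) * η (fun a => stdVec (A a)) := fun J =>
    multilinear_expand η.toMultilinearMap L J
  have key : ∀ A B : Fin k → Fin n,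
      ∑ I : Fin k → Fin n, ∑ J : Fin k → Fin n,
        (∏ a, (P.transpose * G * P)⁻¹ (I a) (J a)) * (∏ a, P (A a) (J a)) * (∏ a, P (B a) (I a)) =
      ∏ a, G⁻¹ (B a) (A a) := by
    intro A B
    have : ∀ a, G⁻¹ (B a) (A a) =
        ∑ i, ∑ j, (P.transpose * G * P)⁻¹ i j * P (A a) j * P (B a) i := by
      intro a
      rw [← hinv, Matrix.mul_apply]
      simp_rw [Matrix.mul_apply, Finset.sum_mul]
      rw [Finset.sum_comm]
      refine Finset.sum_congr rfl fun i _ => Finset.sum_congr rfl fun j _ => ?_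
      rw [Matrix.transpose_apply]; ring
    simp_rw [this]
    rw [Finset.prod_univ_sum]
    simp_rw [Finset.prod_univ_sum, Fintype.piFinset_univ, Finset.prod_mul_distrib]
  unfold starAt
  rw [castDeg_comp]
  simp_rw [contract_comp, contract_expand, hη]
  have hlin : ∀ (r : ℝ) (β : Alt n m),
      (r • β).compContinuousLinearMap L = r • β.compContinuousLinearMap L := fun _ _ => rfl
  have hsum : ∀ {ι : Type} (s : Finset ι) (β : ι → Alt n m),
      (∑ i ∈ s, β i).compContinuousLinearMap L = ∑ i ∈ s, (β i).compContinuousLinearMap L :=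
    fun s β => map_sum (ContinuousAlternatingMap.compContinuousLinearMapₗ (R := ℝ) (N := ℝ)
      (ι := Fin m) L) β s
  rw [hlin]
  congr 1
  simp_rw [hsum, hlin, Finset.smul_sum, smul_smul]
  simp_rw [← key, Finset.sum_mul, Finset.sum_smul, Finset.mul_sum, Finset.sum_mul, Finset.sum_smul]
  have e1 : ∀ (f : (Fin k → Fin n) → (Fin k → Fin n) → (Fin k → Fin n) → (Fin k → Fin n) → Alt n m),
      ∑ I, ∑ J, ∑ B, ∑ A, f I J B A = ∑ B, ∑ A, ∑ I, ∑ J, f I J B A := by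
    intro f
    calc ∑ I, ∑ J, ∑ B, ∑ A, f I J B A = ∑ I, ∑ B, ∑ J, ∑ A, f I J B A :=
          Finset.sum_congr rfl fun I _ => Finset.sum_comm
      _ = ∑ B, ∑ I, ∑ J, ∑ A, f I J B A := Finset.sum_comm
      _ = ∑ B, ∑ I, ∑ A, ∑ J, f I J B A :=
          Finset.sum_congr rfl fun B _ => Finset.sum_congr rfl fun I _ => Finset.sum_comm
      _ = ∑ B, ∑ A, ∑ I, ∑ J, f I J B A := Finset.sum_congr rfl fun B _ => Finset.sum_comm
  rw [e1]
  refine Finset.sum_congr rfl fun B _ => Finset.sum_congr rfl fun A _ =>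
    Finset.sum_congr rfl fun I _ => Finset.sum_congr rfl fun J _ => ?_
  congr 1
  ring

end Star

/-! ### Spacetimes -/

/-- The two kinds of spacetimes: Riemannian and Lorentzian (signature `(-,+,…,+)`). -/
inductive SpacetimeKind where
  | riemannian
  | lorentzian

/-- The diagonal entries of the standard metric on `ℝⁿ`. -/
def SpacetimeKind.eta (s : SpacetimeKind) (n : ℕ) (i : Fin n) : ℝ :=
  match s with
  | .riemannian => 1
  | .lorentzian => if i.val = 0 then -1 else 1

/-- An oriented Riemannian or Lorentzian `n`-manifold. The metric is given by its Gram matrices in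
local parametrizations; the orientation is given by the volume form, i.e. by an `n`-form `vol` with
`vol(e₁,…,eₙ)² = |det g|`. -/
structure Spacetime (s : SpacetimeKind) (n : ℕ) : Type 1 where
  carrier : Type
  [top : TopologicalSpace carrier]
  [charted : ChartedSpace (Euc n) carrier]
  [mfld : IsManifold (𝓡 n) ∞ carrier]
  [t2 : T2Space carrier]
  [sc : SecondCountableTopology carrier]
  metric : Patch n carrier → Euc n → Matrix (Fin n) (Fin n) ℝ
  metric_smooth : ∀ c i j, ContDiffOn ℝ ∞ (fun y => metric c y i j) c.dom
  metric_compat : ∀ c' c h, IsTransition c' c h → ∀ y ∈ c'.dom,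
    metric c' y = (matOf (fderiv ℝ h y)).transpose * metric c (h y) * matOf (fderiv ℝ h y)
  metric_signature : ∀ c, ∀ y ∈ c.dom, ∃ P : Matrix (Fin n) (Fin n) ℝ, IsUnit P.det ∧
    P.transpose * metric c y * P = Matrix.diagonal (s.eta n)
  vol : Patch n carrier → Euc n → Alt n n
  vol_smooth : ∀ c, ContDiffOn ℝ ∞ (vol c) c.dom
  vol_compat : ∀ c' c h, IsTransition c' c h → ∀ y ∈ c'.dom,
    vol c' y = (vol c (h y)).compContinuousLinearMap (fderiv ℝ h y)
  vol_sq : ∀ c, ∀ y ∈ c.dom, (vol c y stdVec) ^ 2 = |(metric c y).det|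

attribute [instance] Spacetime.top Spacetime.charted Spacetime.mfld Spacetime.t2 Spacetime.sc

section Spacetime

variable {s : SpacetimeKind} {n : ℕ}

theorem Spacetime.det_ne_zero (M : Spacetime s n) (c : Patch n M.carrier) {y : Euc n}
    (hy : y ∈ c.dom) : (M.metric c y).det ≠ 0 := by
  obtain ⟨P, hP, h⟩ := M.metric_signature c y hy
  have h2 := congrArg Matrix.det h
  rw [Matrix.det_mul, Matrix.det_mul, Matrix.det_diagonal] at h2
  intro h0
  rw [h0, mul_zero, zero_mul] at h2
  refine absurd h2.symm (Finset.prod_ne_zero_iff.2 fun i _ => ?_)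
  unfold SpacetimeKind.eta
  cases s with
  | riemannian => simp
  | lorentzian => dsimp only; split_ifs <;> norm_num

/-- Morphisms of spacetimes: isometric, orientation-preserving open embeddings. -/
@[ext]
structure SpacetimeHom (M M' : Spacetime s n) where
  toFun : M.carrier → M'.carrier
  injective : Function.Injective toFun
  isLocalDiffeomorph : IsLocalDiffeomorph (𝓡 n) (𝓡 n) ∞ toFun
  metric_eq : ∀ c : Patch n M.carrier, ∀ y ∈ c.dom,
    M'.metric (c.push toFun injective isLocalDiffeomorph) y = M.metric c y
  vol_eq : ∀ c : Patch n M.carrier, ∀ y ∈ c.dom,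
    M'.vol (c.push toFun injective isLocalDiffeomorph) y = M.vol c y

/-- The category of oriented Riemannian (or Lorentzian) `n`-manifolds. -/
instance : Category (Spacetime s n) where
  Hom M M' := SpacetimeHom M M'
  id M :=
    { toFun := id
      injective := Function.injective_id
      isLocalDiffeomorph := (Diffeomorph.refl (𝓡 n) M.carrier ∞).isLocalDiffeomorph
      metric_eq := fun _ _ _ => rfl
      vol_eq := fun _ _ _ => rfl }
  comp f g :=
    { toFun := g.toFun ∘ f.toFun
      injective := g.injective.comp f.injective
      isLocalDiffeomorph := fun x =>
        IsLocalDiffeomorphAt.comp (hf := f.isLocalDiffeomorph x) (hg := g.isLocalDiffeomorph _)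
      metric_eq := fun c y hy => (g.metric_eq (c.push _ f.injective f.isLocalDiffeomorph) y hy).trans
        (f.metric_eq c y hy)
      vol_eq := fun c y hy => (g.vol_eq (c.push _ f.injective f.isLocalDiffeomorph) y hy).trans
        (f.vol_eq c y hy) }

theorem Spacetime.id_toFun (M : Spacetime s n) : SpacetimeHom.toFun (𝟙 M) = id := rfl

theorem Spacetime.comp_toFun {M M' M'' : Spacetime s n} (f : M ⟶ M') (g : M' ⟶ M'') :
    SpacetimeHom.toFun (f ≫ g) = SpacetimeHom.toFun g ∘ SpacetimeHom.toFun f := rfl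

theorem SpacetimeHom.continuous {M M' : Spacetime s n} (f : SpacetimeHom M M') :
    Continuous f.toFun := f.isLocalDiffeomorph.contMDiff.continuous

/-! ### The Hodge star on spacetimes -/

theorem contDiffOn_det {ι : Type} [Fintype ι] [DecidableEq ι] {A : Euc n → Matrix ι ι ℝ}
    {U : Set (Euc n)} (hA : ∀ i j, ContDiffOn ℝ ∞ (fun y => A y i j) U) :
    ContDiffOn ℝ ∞ (fun y => (A y).det) U := by
  simp_rw [Matrix.det_apply']
  refine ContDiffOn.sum fun σ _ => contDiffOn_const.mul ?_
  exact contDiffOn_prod fun i _ => hA _ _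

theorem contDiffOn_inv {A : Euc n → Matrix (Fin n) (Fin n) ℝ} {U : Set (Euc n)}
    (hA : ∀ i j, ContDiffOn ℝ ∞ (fun y => A y i j) U) (hdet : ∀ y ∈ U, (A y).det ≠ 0)
    (i j : Fin n) : ContDiffOn ℝ ∞ (fun y => (A y)⁻¹ i j) U := by
  have h1 : ∀ y, (A y)⁻¹ i j = ((A y).det)⁻¹ * ((A y).updateRow j (Pi.single i 1)).det := by
    intro y
    rw [Matrix.inv_def, Matrix.smul_apply, Matrix.adjugate_apply, Ring.inverse_eq_inv, smul_eq_mul]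
  simp_rw [h1]
  refine ((contDiffOn_det hA).inv hdet).mul (contDiffOn_det fun a b => ?_)
  by_cases ha : a = j
  · subst ha
    simp only [Matrix.updateRow_self]
    exact contDiffOn_const
  · simp only [Matrix.updateRow_ne ha]
    exact hA a b

variable (M : Spacetime s n) {N : ℕ} {X : Type} [TopologicalSpace X] [ChartedSpace (Euc N) X]

open Classical in
/-- The Hodge star of a family of `k`-forms. -/
def Form.starFun {m k : ℕ} (h : n = m + k) (α : Form n M.carrier N X k) :
    Form n M.carrier N X m :=
  ⟨fun c y x => if y ∈ c.dom then starAt h (M.metric c y) (M.vol c y) (α.1 c y x) else 0, by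
    refine ⟨fun c => ?_, fun c y hy x => if_neg hy, fun c' c t H y hy x => ?_⟩
    · have hfst : ContMDiffOn ((𝓡 n).prod (𝓡 N)) (𝓡 n) ∞ (fun z : Euc n × X => z.1)
          (c.dom ×ˢ Set.univ) := contMDiffOn_fst
      have hmaps : Set.MapsTo (fun z : Euc n × X => z.1) (c.dom ×ˢ (Set.univ : Set X)) c.dom :=
        fun z hz => hz.1
      have hG : ∀ i j, ContMDiffOn ((𝓡 n).prod (𝓡 N)) 𝓘(ℝ, ℝ) ∞
          (fun z : Euc n × X => (M.metric c z.1)⁻¹ i j) (c.dom ×ˢ Set.univ) := fun i j =>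
        (contDiffOn_inv (M.metric_smooth c) (fun y hy => M.det_ne_zero c hy) i j).contMDiffOn.comp
          hfst hmaps
      have hν : ContMDiffOn ((𝓡 n).prod (𝓡 N)) 𝓘(ℝ, Alt n n) ∞
          (fun z : Euc n × X => M.vol c z.1) (c.dom ×ˢ Set.univ) :=
        (M.vol_smooth c).contMDiffOn.comp hfst hmaps
      have : ContMDiffOn ((𝓡 n).prod (𝓡 N)) 𝓘(ℝ, Alt n m) ∞
          (fun z : Euc n × X => starAt h (M.metric c z.1) (M.vol c z.1) (α.1 c z.1 z.2))
          (c.dom ×ˢ Set.univ) := by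
        unfold starAt
        have hη : ∀ J : Fin k → Fin n, ContMDiffOn ((𝓡 n).prod (𝓡 N)) 𝓘(ℝ, ℝ) ∞
            (fun z : Euc n × X => α.1 c z.1 z.2 (fun a => stdVec (J a))) (c.dom ×ˢ Set.univ) :=
          fun J => (ContinuousLinearMap.contMDiff (ContinuousAlternatingMap.apply ℝ (Euc n) ℝ
            (fun a => stdVec (J a)))).comp_contMDiffOn (α.smooth c)
        have hC : ∀ I : Fin k → Fin n, ContMDiffOn ((𝓡 n).prod (𝓡 N)) 𝓘(ℝ, Alt n m) ∞
            (fun z : Euc n × X => contract m k (fun a => stdVec (I a)) (castDeg h (M.vol c z.1)))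
            (c.dom ×ˢ Set.univ) :=
          fun I => (ContinuousLinearMap.contMDiff ((contract m k fun a => stdVec (I a)) ∘L
            (castDeg h))).comp_contMDiffOn hν
        have hp : ∀ I J : Fin k → Fin n, ContMDiffOn ((𝓡 n).prod (𝓡 N)) 𝓘(ℝ, ℝ) ∞
            (fun z : Euc n × X => ∏ a, (M.metric c z.1)⁻¹ (I a) (J a)) (c.dom ×ˢ Set.univ) :=
          fun I J => contMDiffOn_finsetProd fun a _ => hG _ _
        have hk : ContMDiffOn ((𝓡 n).prod (𝓡 N)) 𝓘(ℝ, ℝ) ∞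
            (fun _ : Euc n × X => ((k.factorial : ℝ)⁻¹)) (c.dom ×ˢ Set.univ) := contMDiffOn_const
        refine hk.smul ?_
        exact contMDiffOn_finsetSum fun I _ => contMDiffOn_finsetSum
          fun J _ => ContMDiffOn.smul ((hp I J).mul (hη J)) (hC I)
      exact this.congr fun z hz => if_pos hz.1
    · beta_reduce
      rw [if_pos hy, if_pos (H.mapsTo hy), M.metric_compat c' c t H y hy,
        M.vol_compat c' c t H y hy, α.compat H hy]
      refine starAt_comp h _ _ _ _ ?_
      rw [← M.metric_compat c' c t H y hy]
      exact M.det_ne_zero c' hy⟩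

theorem Form.starFun_apply {m k : ℕ} (h : n = m + k) (α : Form n M.carrier N X k)
    (c : Patch n M.carrier) {y : Euc n} (hy : y ∈ c.dom) (x : X) :
    (Form.starFun M h α).1 c y x = starAt h (M.metric c y) (M.vol c y) (α.1 c y x) := if_pos hy

theorem starAt_add {m k : ℕ} (h : n = m + k) (G : Matrix (Fin n) (Fin n) ℝ) (ν : Alt n n)
    (η ζ : Alt n k) : starAt h G ν (η + ζ) = starAt h G ν η + starAt h G ν ζ := by
  simp only [starAt, ContinuousAlternatingMap.add_apply, mul_add, add_smul, Finset.sum_add_distrib,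
    smul_add]

theorem starAt_smul {m k : ℕ} (h : n = m + k) (G : Matrix (Fin n) (Fin n) ℝ) (ν : Alt n n)
    (r : ℝ) (η : Alt n k) : starAt h G ν (r • η) = r • starAt h G ν η := by
  simp only [starAt, ContinuousAlternatingMap.smul_apply, Finset.smul_sum, smul_smul, smul_eq_mul]
  refine Finset.sum_congr rfl fun I _ => Finset.sum_congr rfl fun J _ => ?_
  congr 1
  ring

/-- The Hodge star as a map that is linear over the functions of the parameters. -/
def Form.star {m k : ℕ} (h : n = m + k) : Form n M.carrier N X k →ₗ[Sm N X] Form n M.carrier N X m where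
  toFun := Form.starFun M h
  map_add' α β := Form.ext fun c y hy x => by
    rw [Form.add_apply, Form.starFun_apply M h _ c hy, Form.starFun_apply M h _ c hy,
      Form.starFun_apply M h _ c hy, Form.add_apply, starAt_add]
  map_smul' r α := Form.ext fun c y hy x => by
    rw [RingHom.id_apply, Form.smul_apply, Form.starFun_apply M h _ c hy,
      Form.starFun_apply M h _ c hy, Form.smul_apply, starAt_smul]

theorem Form.pull_star {m k : ℕ} (h : n = m + k) {M M' : Spacetime s n} (f : SpacetimeHom M M')
    {N' : ℕ} {X' : Type} [TopologicalSpace X'] [ChartedSpace (Euc N') X'] (φ : SmMap N X N' X')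
    (α : Form n M'.carrier N' X' k) :
    Form.pull f.toFun f.injective f.isLocalDiffeomorph φ (Form.star M' h α) =
      Form.star M h (Form.pull f.toFun f.injective f.isLocalDiffeomorph φ α) :=
  Form.ext fun c y hy x => by
    rw [Form.pull_apply]
    refine (Form.starFun_apply M' h α (c.push _ f.injective f.isLocalDiffeomorph) hy (φ x)).trans ?_
    refine Eq.trans ?_ (Form.starFun_apply M h _ c hy x).symm
    rw [f.metric_eq c y hy, f.vol_eq c y hy]
    rfl

end Spacetime

/-! ### dg manifolds: the test objects -/

section Graded

variable {R A : Type} [CommRing R] [Ring A] [Algebra R A]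

/-- Graded commutativity, with the Koszul sign. -/
def IsGradedCommutative (𝒜 : ℤ → Submodule R A) : Prop :=
  ∀ i j a b, a ∈ 𝒜 i → b ∈ 𝒜 j → a * b = ((i * j).negOnePow : ℤ) • (b * a)

/-- `A` is the free graded-commutative algebra on the graded module `E`. -/
def IsGradedSymmetricAlgebra (𝒜 E : ℤ → Submodule R A) : Prop :=
  (∀ j, E j ≤ 𝒜 j) ∧
  ∀ (B : Type) [Ring B] [Algebra R B] (ℬ : ℤ → Submodule R B) [GradedAlgebra ℬ],
    IsGradedCommutative ℬ → ∀ f : (j : ℤ) → E j →ₗ[R] B, (∀ j e, f j e ∈ ℬ j) →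
      ∃! F : A →ₐ[R] B, ∀ j (e : E j), F e = f j e

end Graded

/-- A dg manifold: a smooth manifold `base`, together with a differential graded algebra `alg` over
`C^∞(base)` whose underlying graded algebra is the algebra of sections of the graded symmetric
algebra of a bounded graded vector bundle in negative degrees (the sections of the bundle in each
degree form a finitely generated projective module). The differential `Q` has degree `1`. -/
structure DGManifold : Type 1 where
  dim : ℕ
  base : Type
  [top : TopologicalSpace base]
  [charted : ChartedSpace (Euc dim) base]
  [mfld : IsManifold (𝓡 dim) ∞ base]
  [t2 : T2Space base]
  [sc : SecondCountableTopology base]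
  alg : Type
  [ring : Ring alg]
  [algebra : Algebra (Sm dim base) alg]
  grading : ℤ → Submodule (Sm dim base) alg
  [graded : GradedAlgebra grading]
  comm : IsGradedCommutative grading
  exists_bundle : ∃ E : ℤ → Submodule (Sm dim base) alg, IsGradedSymmetricAlgebra grading E ∧
    (∀ j, Module.Finite (Sm dim base) (E j) ∧ Module.Projective (Sm dim base) (E j)) ∧
    (∀ j, 0 ≤ j → E j = ⊥) ∧ {j | E j ≠ ⊥}.Finite
  Q : alg →ₗ[Sm dim base] alg
  Q_mem : ∀ j a, a ∈ grading j → Q a ∈ grading (j + 1)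
  Q_mul : ∀ i a b, a ∈ grading i → Q (a * b) = Q a * b + (i.negOnePow : ℤ) • (a * Q b)
  Q_Q : ∀ a, Q (Q a) = 0

attribute [instance] DGManifold.top DGManifold.charted DGManifold.mfld DGManifold.t2 DGManifold.sc
  DGManifold.ring DGManifold.algebra DGManifold.graded

/-- The functions on the base of a dg manifold. -/
abbrev DGManifold.Fn (𝓜 : DGManifold) : Type := Sm 𝓜.dim 𝓜.base

/-- A map of dg manifolds: a smooth map of the bases and a compatible map of dg algebras in the
opposite direction. -/
@[ext]
structure DGManifoldHom (𝓜 𝓝 : DGManifold) where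
  onBase : SmMap 𝓜.dim 𝓜.base 𝓝.dim 𝓝.base
  onAlg : 𝓝.alg →+* 𝓜.alg
  onAlg_algebraMap : ∀ r : 𝓝.Fn, onAlg (algebraMap _ _ r) = algebraMap _ _ (onBase.pull r)
  onAlg_mem : ∀ j a, a ∈ 𝓝.grading j → onAlg a ∈ 𝓜.grading j
  onAlg_Q : ∀ a, onAlg (𝓝.Q a) = 𝓜.Q (onAlg a)

/-- The category of dg manifolds. -/
instance : Category DGManifold where
  Hom 𝓜 𝓝 := DGManifoldHom 𝓜 𝓝
  id 𝓜 :=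
    { onBase := ContMDiffMap.id
      onAlg := RingHom.id _
      onAlg_algebraMap := fun _ => rfl
      onAlg_mem := fun _ _ h => h
      onAlg_Q := fun _ => rfl }
  comp f g :=
    { onBase := g.onBase.comp f.onBase
      onAlg := f.onAlg.comp g.onAlg
      onAlg_algebraMap := fun r => by
        rw [RingHom.comp_apply, g.onAlg_algebraMap, f.onAlg_algebraMap]; rfl
      onAlg_mem := fun j a h => f.onAlg_mem j _ (g.onAlg_mem j a h)
      onAlg_Q := fun a => by
        rw [RingHom.comp_apply, g.onAlg_Q, f.onAlg_Q]; rfl }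

/-- The map on algebras is semilinear over the pull-back of functions. -/
def DGManifoldHom.onAlgₛₗ {𝓜 𝓝 : DGManifold} (f : DGManifoldHom 𝓜 𝓝) :
    𝓝.alg →ₛₗ[f.onBase.pull] 𝓜.alg where
  toFun := f.onAlg
  map_add' := map_add _
  map_smul' r a := by
    rw [Algebra.smul_def, map_mul, f.onAlg_algebraMap, Algebra.smul_def]

/-- Equivalences of derived manifolds: maps inducing an isomorphism on the cohomology of the dg
algebras of functions. -/
def DGManifold.weakEquivalences : MorphismProperty DGManifold := fun 𝓜 𝓝 (f : DGManifoldHom 𝓜 𝓝) =>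
  (∀ a, 𝓝.Q a = 0 → (∃ b, f.onAlg a = 𝓜.Q b) → ∃ b', a = 𝓝.Q b') ∧
  (∀ a, 𝓜.Q a = 0 → ∃ a', 𝓝.Q a' = 0 ∧ ∃ b, a = f.onAlg a' + 𝓜.Q b)

/-- The underlying topological space of the derived manifold: the locus in the base where all
`Q a`, with `a` of degree `-1`, vanish. -/
def DGManifold.locus (𝓜 : DGManifold) : Set 𝓜.base :=
  {x | ∀ a ∈ 𝓜.grading (-1), ∀ r : 𝓜.Fn, 𝓜.Q a = algebraMap _ _ r → r x = 0}

/-- Open embeddings of dg manifolds: the map of bases is an open embedding and the algebra of the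
source is obtained from that of the target by restriction, i.e. the canonical map
`C^∞(base of 𝓜) ⊗_{C^∞(base of 𝓝)} 𝓝.alg → 𝓜.alg` is bijective. -/
structure DGManifoldHom.IsOpenEmbedding {𝓜 𝓝 : DGManifold} (f : DGManifoldHom 𝓜 𝓝) : Prop where
  injective : Function.Injective f.onBase
  isLocalDiffeomorph : IsLocalDiffeomorph (𝓡 𝓜.dim) (𝓡 𝓝.dim) ∞ f.onBase
  bijective :
    letI : Module 𝓝.Fn 𝓜.Fn := Module.compHom _ f.onBase.pull
    Function.Bijective (TensorProduct.liftAddHom (R := 𝓝.Fn) (M := 𝓜.Fn) (N := 𝓝.alg)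
      ({ toFun := fun r => (AddMonoidHom.mulLeft (algebraMap 𝓜.Fn 𝓜.alg r)).comp f.onAlg.toAddMonoidHom
         map_zero' := by ext; simp
         map_add' := fun r r' => by ext; simp [add_mul] } : 𝓜.Fn →+ 𝓝.alg →+ 𝓜.alg)
      (fun t r a => by
        change algebraMap 𝓜.Fn 𝓜.alg (f.onBase.pull t * r) * f.onAlg a =
          algebraMap 𝓜.Fn 𝓜.alg r * f.onAlg (t • a)
        rw [Algebra.smul_def, map_mul, map_mul, f.onAlg_algebraMap, ← mul_assoc, ← map_mul,
          ← map_mul, mul_comm r]))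

/-! ### The site of spacetimes and test objects -/

/-- The category of pairs of a spacetime and a test object. -/
abbrev TestedSpacetime (s : SpacetimeKind) (n : ℕ) : Type 1 := Spacetime s n × DGManifold

/-- The basic covering families: a family of morphisms `Uᵢ → M` of spacetimes with
`M = ⋃ᵢ im Uᵢ`, with the test object fixed, or a family of open embeddings `𝓤ᵢ → 𝓜` of test
objects whose images cover the underlying space of `𝓜`, with the spacetime fixed. -/
inductive IsBasicCover {s : SpacetimeKind} {n : ℕ} :
    (c : TestedSpacetime s n) → Presieve c → Prop
  | spacetime (M : Spacetime s n) (𝓜 : DGManifold) (ι : Type) (U : ι → Spacetime s n)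
      (f : (i : ι) → U i ⟶ M) (hf : ∀ x : M.carrier, ∃ i u, SpacetimeHom.toFun (f i) u = x) :
      IsBasicCover (M, 𝓜) (Presieve.ofArrows (fun i => (U i, 𝓜)) (fun i => (f i, 𝟙 𝓜)))
  | test (M : Spacetime s n) (𝓜 : DGManifold) (ι : Type) (𝓤 : ι → DGManifold)
      (f : (i : ι) → 𝓤 i ⟶ 𝓜) (hf : ∀ i, DGManifoldHom.IsOpenEmbedding (f i))
      (hf' : ∀ x ∈ 𝓜.locus, ∃ i u, DGManifoldHom.onBase (f i) u = x) :
      IsBasicCover (M, 𝓜) (Presieve.ofArrows (fun i => (M, 𝓤 i)) (fun i => (𝟙 M, f i)))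

/-- The topology generated by the basic covering families. -/
def siteTopology (s : SpacetimeKind) (n : ℕ) : GrothendieckTopology (TestedSpacetime s n) :=
  Precoverage.toGrothendieck ⟨fun c => {R | IsBasicCover c R}⟩

/-- The morphisms of the site that are equivalences of test objects over a fixed spacetime. -/
inductive IsTestEquivalence {s : SpacetimeKind} {n : ℕ} :
    {c c' : TestedSpacetime s n} → (c ⟶ c') → Prop
  | mk (M : Spacetime s n) {𝓜 𝓝 : DGManifold} (f : 𝓜 ⟶ 𝓝) (hf : DGManifold.weakEquivalences f) :
      IsTestEquivalence (c := (M, 𝓜)) (c' := (M, 𝓝)) (𝟙 M, f)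

/-! ### Forms on spacetime with values in the functions on a test object -/

section Fields

variable {s : SpacetimeKind} {n : ℕ}

/-- `Ωᵏ_M(𝓜)`: sections of the pull-back of `Λᵏ T^*M` to `M × 𝓜`, as an ungraded group. -/
abbrev AForm (c : TestedSpacetime s n) (k : ℕ) : Type :=
  Form n c.1.carrier c.2.dim c.2.base k ⊗[c.2.Fn] c.2.alg

/-- The locally constant integer-valued functions on `M × base(𝓜)`. -/
abbrev IntFn (c : TestedSpacetime s n) : Type := LocallyConstant (c.1.carrier × c.2.base) ℤ

namespace AForm

variable (c : TestedSpacetime s n)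

/-- The part of `Ωᵏ_M(𝓜)` of internal degree `j`. -/
def deg (k : ℕ) (j : ℤ) : Submodule c.2.Fn (AForm c k) :=
  LinearMap.range (LinearMap.lTensor (Form n c.1.carrier c.2.dim c.2.base k)
    (c.2.grading j).subtype)

/-- The exterior derivative in the direction of spacetime. -/
def d (k : ℕ) : AForm c k →ₗ[c.2.Fn] AForm c (k + 1) := LinearMap.rTensor _ (Form.d k)

/-- The Hodge star. -/
def star {m k : ℕ} (h : n = m + k) : AForm c k →ₗ[c.2.Fn] AForm c m :=
  LinearMap.rTensor _ (Form.star c.1 h)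

/-- The internal differential of the test object. -/
def Q (k : ℕ) : AForm c k →ₗ[c.2.Fn] AForm c k := LinearMap.lTensor _ c.2.Q

/-- The inclusion of locally constant functions, scaled by `m`. -/
def ofInt (m : ℝ) : IntFn c →+ AForm c 0 :=
  ((TensorProduct.mk c.2.Fn _ c.2.alg).flip 1).toAddMonoidHom.comp (Form.ofInt m)

/-- Multiplication by a real constant. -/
def scale (k : ℕ) (r : ℝ) : AForm c k →ₗ[c.2.Fn] AForm c k :=
  LinearMap.lsmul c.2.Fn _ (algebraMap ℝ c.2.Fn r)

variable {c}

theorem d_d {k : ℕ} (α : AForm c k) : d c (k + 1) (d c k α) = 0 := by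
  induction α using TensorProduct.induction_on with
  | zero => simp
  | tmul α a => simp [d, Form.d_d]
  | add x y hx hy => rw [map_add, map_add, hx, hy, add_zero]

theorem Q_Q {k : ℕ} (α : AForm c k) : Q c k (Q c k α) = 0 := by
  induction α using TensorProduct.induction_on with
  | zero => simp
  | tmul α a => simp [Q, c.2.Q_Q]
  | add x y hx hy => rw [map_add, map_add, hx, hy, add_zero]

theorem d_Q {k : ℕ} (α : AForm c k) : d c k (Q c k α) = Q c (k + 1) (d c k α) := by
  induction α using TensorProduct.induction_on with
  | zero => simp
  | tmul α a => simp [d, Q]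
  | add x y hx hy => simp only [map_add, hx, hy]

theorem star_Q {m k : ℕ} (h : n = m + k) (α : AForm c k) :
    star c h (Q c k α) = Q c m (star c h α) := by
  induction α using TensorProduct.induction_on with
  | zero => simp
  | tmul α a => simp [star, Q]
  | add x y hx hy => simp only [map_add, hx, hy]

theorem Q_one : c.2.Q 1 = 0 := by
  have h := c.2.Q_mul 0 1 1 (SetLike.GradedOne.one_mem)
  simpa using h

theorem Q_ofInt (m : ℝ) (z : IntFn c) : Q c 0 (ofInt c m z) = 0 := by
  change Form.ofInt m z ⊗ₜ[c.2.Fn] c.2.Q 1 = 0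
  rw [Q_one, TensorProduct.tmul_zero]

theorem d_ofInt (m : ℝ) (z : IntFn c) : d c 0 (ofInt c m z) = 0 := by
  change Form.d 0 (Form.ofInt m z) ⊗ₜ[c.2.Fn] (1 : c.2.alg) = 0
  rw [Form.d_ofInt, TensorProduct.zero_tmul]

theorem ofInt_mem (m : ℝ) (z : IntFn c) : ofInt c m z ∈ deg c 0 0 :=
  ⟨Form.ofInt m z ⊗ₜ ⟨1, SetLike.GradedOne.one_mem⟩, rfl⟩

theorem map_mem_deg {k k' : ℕ} {j j' : ℤ} (f : AForm c k →ₗ[c.2.Fn] AForm c k')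
    (hf : ∀ α, ∀ a ∈ c.2.grading j, f (α ⊗ₜ a) ∈ deg c k' j') {v : AForm c k}
    (hv : v ∈ deg c k j) : f v ∈ deg c k' j' := by
  obtain ⟨w, rfl⟩ := hv
  induction w using TensorProduct.induction_on with
  | zero => simp
  | tmul α a => exact hf α a a.2
  | add x y hx hy => rw [map_add, map_add]; exact add_mem hx hy

theorem tmul_mem_deg {k : ℕ} {j : ℤ} (α : Form n c.1.carrier c.2.dim c.2.base k) {a : c.2.alg}
    (ha : a ∈ c.2.grading j) : (α ⊗ₜ a : AForm c k) ∈ deg c k j :=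
  ⟨α ⊗ₜ ⟨a, ha⟩, rfl⟩

theorem d_mem {k : ℕ} {j : ℤ} {v : AForm c k} (hv : v ∈ deg c k j) : d c k v ∈ deg c (k + 1) j :=
  map_mem_deg (d c k) (fun α _ ha => tmul_mem_deg (Form.d k α) ha) hv

theorem star_mem {m k : ℕ} (h : n = m + k) {j : ℤ} {v : AForm c k} (hv : v ∈ deg c k j) :
    star c h v ∈ deg c m j :=
  map_mem_deg (star c h) (fun α _ ha => tmul_mem_deg (Form.star c.1 h α) ha) hv

theorem Q_mem {k : ℕ} {j : ℤ} {v : AForm c k} (hv : v ∈ deg c k j) : Q c k v ∈ deg c k (j + 1) :=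
  map_mem_deg (Q c k) (fun α a ha => tmul_mem_deg α (c.2.Q_mem j a ha)) hv

theorem scale_mem {k : ℕ} (r : ℝ) {j : ℤ} {v : AForm c k} (hv : v ∈ deg c k j) :
    scale c k r v ∈ deg c k j := Submodule.smul_mem _ _ hv

theorem scale_Q {k : ℕ} (r : ℝ) (v : AForm c k) :
    scale c k r (Q c k v) = Q c k (scale c k r v) := ((Q c k).map_smul _ v).symm

variable {c' c'' : TestedSpacetime s n}

/-- Pull-back along a morphism of the site. -/
def pull (f : c ⟶ c') (k : ℕ) : AForm c' k →ₛₗ[(DGManifoldHom.onBase f.2).pull] AForm c k :=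
  TensorProduct.map
    (Form.pull (SpacetimeHom.toFun f.1) (SpacetimeHom.injective f.1)
      (SpacetimeHom.isLocalDiffeomorph f.1) (DGManifoldHom.onBase f.2))
    (DGManifoldHom.onAlgₛₗ f.2)

/-- Pull-back of locally constant functions. -/
def pullInt (f : c ⟶ c') : IntFn c' →+ IntFn c where
  toFun := LocallyConstant.comap ⟨fun u => (SpacetimeHom.toFun f.1 u.1, DGManifoldHom.onBase f.2 u.2),
    ((SpacetimeHom.continuous f.1).comp continuous_fst).prodMk
      ((DGManifoldHom.onBase f.2).contMDiff.continuous.comp continuous_snd)⟩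
  map_zero' := rfl
  map_add' _ _ := rfl

theorem pull_tmul (f : c ⟶ c') (k : ℕ) (α : Form n c'.1.carrier c'.2.dim c'.2.base k)
    (a : c'.2.alg) : pull f k (α ⊗ₜ a) =
      (Form.pull (SpacetimeHom.toFun f.1) (SpacetimeHom.injective f.1)
        (SpacetimeHom.isLocalDiffeomorph f.1) (DGManifoldHom.onBase f.2) α) ⊗ₜ
        DGManifoldHom.onAlg f.2 a := TensorProduct.map_tmul _ _ _ _

theorem pull_d (f : c ⟶ c') (k : ℕ) (v : AForm c' k) :
    pull f (k + 1) (d c' k v) = d c k (pull f k v) := by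
  induction v using TensorProduct.induction_on with
  | zero => simp
  | tmul α a => simp [d, pull_tmul, Form.pull_d]
  | add x y hx hy => simp only [map_add, hx, hy]

theorem pull_star (f : c ⟶ c') {m k : ℕ} (h : n = m + k) (v : AForm c' k) :
    pull f m (star c' h v) = star c h (pull f k v) := by
  induction v using TensorProduct.induction_on with
  | zero => simp
  | tmul α a =>
    simp only [star, pull_tmul, LinearMap.rTensor_tmul]
    rw [Form.pull_star]
  | add x y hx hy => simp only [map_add, hx, hy]

theorem pull_Q (f : c ⟶ c') (k : ℕ) (v : AForm c' k) :
    pull f k (Q c' k v) = Q c k (pull f k v) := by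
  induction v using TensorProduct.induction_on with
  | zero => simp
  | tmul α a => simp [Q, pull_tmul, DGManifoldHom.onAlg_Q]
  | add x y hx hy => simp only [map_add, hx, hy]

theorem pull_scale (f : c ⟶ c') (k : ℕ) (r : ℝ) (v : AForm c' k) :
    pull f k (scale c' k r v) = scale c k r (pull f k v) := (pull f k).map_smulₛₗ _ v

theorem pull_ofInt (f : c ⟶ c') (m : ℝ) (z : IntFn c') :
    pull f 0 (ofInt c' m z) = ofInt c m (pullInt f z) := by
  change pull f 0 (Form.ofInt m z ⊗ₜ (1 : c'.2.alg)) = Form.ofInt m _ ⊗ₜ (1 : c.2.alg)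
  rw [pull_tmul, map_one]
  rw [Form.pull_ofInt m _ _ _ _ z
    ⟨fun u => (SpacetimeHom.toFun f.1 u.1, DGManifoldHom.onBase f.2 u.2),
      ((SpacetimeHom.continuous f.1).comp continuous_fst).prodMk
        ((DGManifoldHom.onBase f.2).contMDiff.continuous.comp continuous_snd)⟩ (fun _ => rfl)]
  rfl

theorem pull_mem (f : c ⟶ c') {k : ℕ} {j : ℤ} {v : AForm c' k} (hv : v ∈ deg c' k j) :
    pull f k v ∈ deg c k j := by
  obtain ⟨w, rfl⟩ := hv
  induction w using TensorProduct.induction_on with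
  | zero => simp
  | tmul α a =>
    rw [LinearMap.lTensor_tmul, pull_tmul]
    exact tmul_mem_deg _ (DGManifoldHom.onAlg_mem f.2 j _ a.2)
  | add x y hx hy => rw [map_add, map_add]; exact add_mem hx hy

theorem pull_id (k : ℕ) (v : AForm c k) : pull (𝟙 c) k v = v := by
  induction v using TensorProduct.induction_on with
  | zero => simp
  | tmul α a => rw [pull_tmul]; rfl
  | add x y hx hy => rw [map_add, hx, hy]

theorem pull_comp (f : c ⟶ c') (g : c' ⟶ c'') (k : ℕ) (v : AForm c'' k) :
    pull (f ≫ g) k v = pull f k (pull g k v) := by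
  induction v using TensorProduct.induction_on with
  | zero => simp
  | tmul α a => rw [pull_tmul, pull_tmul, pull_tmul]; rfl
  | add x y hx hy => rw [map_add, hx, hy, map_add, map_add]

end AForm


/-! ### The charge-discretized theory as a presheaf of cochain complexes -/

section Row

variable (c : TestedSpacetime s n)

/-- The underlying ungraded group of a row `ℤ → Ω⁰ → ⋯ → Ωᵖ` (of the components `Ωᵏ`, only those
with `k ≤ p` are used, see `rowGr`). -/
abbrev Row : Type := IntFn c × ((k : ℕ) → AForm c k)

/-- The total differential of a row `ℤ → Ω⁰ → ⋯ → Ωᵖ`, whose first map is the inclusion times `m`.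
The component `Ωᵏ` sits in degree `k - p`, which gives the sign in front of `Q`. -/
def rowD (p : ℕ) (m : ℝ) : Row c →+ Row c where
  toFun u := (0, fun k => match k with
    | 0 => AForm.ofInt c m u.1 + (-1 : ℤ) ^ p • AForm.Q c 0 (u.2 0)
    | k + 1 => if k + 1 ≤ p then
        AForm.d c k (u.2 k) + (-1 : ℤ) ^ (p + (k + 1)) • AForm.Q c (k + 1) (u.2 (k + 1)) else 0)
  map_zero' := by
    refine Prod.ext rfl (funext fun k => ?_)
    cases k <;> simp
  map_add' _ _ := by
    refine Prod.ext (by simp) (funext fun k => ?_)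
    cases k with
    | zero => simp only [Prod.fst_add, Prod.snd_add, Pi.add_apply, map_add, smul_add]; abel
    | succ k =>
      simp only [Prod.snd_add, Pi.add_apply, map_add, smul_add]
      split_ifs
      · abel
      · simp

variable {c}

theorem rowD_fst (p : ℕ) (m : ℝ) (u : Row c) : (rowD c p m u).1 = 0 := rfl

theorem rowD_zero (p : ℕ) (m : ℝ) (u : Row c) : (rowD c p m u).2 0 =
    AForm.ofInt c m u.1 + (-1 : ℤ) ^ p • AForm.Q c 0 (u.2 0) := rfl

theorem rowD_succ (p : ℕ) (m : ℝ) (u : Row c) (k : ℕ) : (rowD c p m u).2 (k + 1) =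
    if k + 1 ≤ p then AForm.d c k (u.2 k) +
      (-1 : ℤ) ^ (p + (k + 1)) • AForm.Q c (k + 1) (u.2 (k + 1)) else 0 := rfl

theorem rowD_rowD (p : ℕ) (m : ℝ) (u : Row c) : rowD c p m (rowD c p m u) = 0 := by
  refine Prod.ext rfl (funext fun k => ?_)
  cases k with
  | zero =>
    rw [rowD_zero, rowD_fst, rowD_zero]
    simp [AForm.Q_ofInt, AForm.Q_Q]
  | succ k =>
    rw [rowD_succ, rowD_succ]
    split_ifs with hk
    · cases k with
      | zero =>
        rw [rowD_zero]
        simp only [map_add, map_zsmul, AForm.d_ofInt, AForm.Q_Q, AForm.d_Q, smul_zero, zero_add,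
          add_zero, pow_add, pow_one]
        simp
      | succ k =>
        rw [rowD_succ, if_pos (by omega)]
        simp only [map_add, map_zsmul, AForm.d_d, AForm.Q_Q, AForm.d_Q, smul_zero, zero_add,
          add_zero, pow_add, pow_one]
        simp
    · rfl

theorem d_rowD (p : ℕ) (m : ℝ) (u : Row c) :
    AForm.d c p ((rowD c p m u).2 p) = AForm.Q c (p + 1) (AForm.d c p (u.2 p)) := by
  cases p with
  | zero => rw [rowD_zero]; simp [AForm.d_ofInt, AForm.d_Q]
  | succ p =>
    rw [rowD_succ, if_pos le_rfl, map_add, AForm.d_d, zero_add, map_zsmul, AForm.d_Q,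
      Even.neg_one_pow ⟨_, rfl⟩, one_smul]

variable (c) in
/-- The part of total degree `i` of a row `ℤ → Ω⁰ → ⋯ → Ωᵖ`: the group `ℤ` sits in degree
`-p-1` and the component `Ωᵏ(𝓜)` of internal degree `j` in degree `k - p + j`. -/
def rowGr (p : ℕ) (i : ℤ) : AddSubgroup (Row c) where
  carrier := {u | (i ≠ -p - 1 → u.1 = 0) ∧ (∀ k ≤ p, u.2 k ∈ AForm.deg c k (i + p - k)) ∧
    ∀ k, p < k → u.2 k = 0}
  zero_mem' := ⟨fun _ => rfl, fun _ _ => zero_mem _, fun _ _ => rfl⟩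
  add_mem' {u v} hu hv := ⟨fun h => by rw [Prod.fst_add, hu.1 h, hv.1 h, add_zero],
    fun k hk => add_mem (hu.2.1 k hk) (hv.2.1 k hk),
    fun k hk => by rw [Prod.snd_add, Pi.add_apply, hu.2.2 k hk, hv.2.2 k hk, add_zero]⟩
  neg_mem' {u} hu := ⟨fun h => by rw [Prod.fst_neg, hu.1 h, neg_zero],
    fun k hk => neg_mem (hu.2.1 k hk),
    fun k hk => by rw [Prod.snd_neg, Pi.neg_apply, hu.2.2 k hk, neg_zero]⟩

theorem rowD_mem (p : ℕ) (m : ℝ) {i : ℤ} {u : Row c} (hu : u ∈ rowGr c p i) :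
    rowD c p m u ∈ rowGr c p (i + 1) := by
  refine ⟨fun _ => rfl, fun k hk => ?_, fun k hk => ?_⟩
  · cases k with
    | zero =>
      rw [rowD_zero]
      refine add_mem ?_ (zsmul_mem ?_ _)
      · by_cases hi : i = -p - 1
        · have := AForm.ofInt_mem m u.1
          rwa [show (0 : ℤ) = i + 1 + p - (0 : ℕ) by rw [hi]; push_cast; ring] at this
        · rw [hu.1 hi, map_zero]; exact zero_mem _
      · have := AForm.Q_mem (hu.2.1 0 hk)
        rwa [show i + p - (0 : ℕ) + 1 = i + 1 + p - (0 : ℕ) by ring] at this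
    | succ k =>
      rw [rowD_succ, if_pos hk]
      refine add_mem ?_ (zsmul_mem ?_ _)
      · have := AForm.d_mem (hu.2.1 k (by omega))
        rwa [show i + p - (k : ℤ) = i + 1 + p - ((k + 1 : ℕ) : ℤ) by push_cast; ring] at this
      · have := AForm.Q_mem (hu.2.1 (k + 1) hk)
        rwa [show i + p - ((k + 1 : ℕ) : ℤ) + 1 = i + 1 + p - ((k + 1 : ℕ) : ℤ) by ring] at this
  · cases k with
    | zero => omega
    | succ k => rw [rowD_succ, if_neg (by omega)]

variable {c' c'' : TestedSpacetime s n}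

/-- Pull-back of a row. -/
def rowPull (f : c ⟶ c') : Row c' →+ Row c where
  toFun u := (AForm.pullInt f u.1, fun k => AForm.pull f k (u.2 k))
  map_zero' := Prod.ext (map_zero _) (funext fun k => map_zero (AForm.pull f k))
  map_add' _ _ := Prod.ext (map_add _ _ _) (funext fun k => map_add (AForm.pull f k) _ _)

theorem rowPull_rowD (f : c ⟶ c') (p : ℕ) (m : ℝ) (u : Row c') :
    rowPull f (rowD c' p m u) = rowD c p m (rowPull f u) := by
  refine Prod.ext (map_zero _) (funext fun k => ?_)
  change AForm.pull f k ((rowD c' p m u).2 k) = _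
  cases k with
  | zero => rw [rowD_zero, rowD_zero, map_add, map_zsmul, AForm.pull_ofInt, AForm.pull_Q]; rfl
  | succ k =>
    rw [rowD_succ, rowD_succ]
    split_ifs
    · rw [map_add, map_zsmul, AForm.pull_d, AForm.pull_Q]; rfl
    · exact map_zero _

theorem rowPull_mem (f : c ⟶ c') (p : ℕ) {i : ℤ} {u : Row c'} (hu : u ∈ rowGr c' p i) :
    rowPull f u ∈ rowGr c p i := by
  refine ⟨fun hi => ?_, fun k hk => AForm.pull_mem f (hu.2.1 k hk), fun k hk => ?_⟩
  · change AForm.pullInt f u.1 = 0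
    rw [hu.1 hi, map_zero]
  · change AForm.pull f k (u.2 k) = 0
    rw [hu.2.2 k hk, map_zero]

theorem rowPull_id (u : Row c) : rowPull (𝟙 c) u = u :=
  Prod.ext rfl (funext fun _ => AForm.pull_id _ _)

theorem rowPull_comp (f : c ⟶ c') (g : c' ⟶ c'') (u : Row c'') :
    rowPull (f ≫ g) u = rowPull f (rowPull g u) :=
  Prod.ext rfl (funext fun _ => AForm.pull_comp _ _ _ _)

end Row

section Complex

variable (c : TestedSpacetime s n)

/-- The underlying ungraded group of the complex: the two rows, and the forms of degree `q + 1`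
at the right end. -/
abbrev Fields (q : ℕ) : Type := Row c × Row c × AForm c (q + 1)

variable (p q : ℕ) (h : n = (q + 1) + (p + 1)) (κ e : ℝ)

/-- The total differential: the differentials of the two rows, and
`(A, C, G) ↦ ⋆ d A_p - κ d C_q - Q G` at the right end, which sits in degree `1`. -/
def fieldsD : Fields c q →+ Fields c q where
  toFun u := (rowD c p 1 u.1, rowD c q e u.2.1,
    AForm.star c h (AForm.d c p (u.1.2 p)) - AForm.scale c _ κ (AForm.d c q (u.2.1.2 q)) -
      AForm.Q c (q + 1) u.2.2)
  map_zero' := by simp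
  map_add' u v := by
    refine Prod.ext (map_add _ _ _) (Prod.ext (map_add _ _ _) ?_)
    simp only [Prod.fst_add, Prod.snd_add, Pi.add_apply, map_add]
    abel

/-- The part of total degree `i`. -/
def fieldsGr (i : ℤ) : AddSubgroup (Fields c q) :=
  (rowGr c p i).prod ((rowGr c q i).prod (AForm.deg c (q + 1) (i - 1)).toAddSubgroup)

variable {c}

theorem fieldsD_fieldsD (u : Fields c q) : fieldsD c p q h κ e (fieldsD c p q h κ e u) = 0 := by
  refine Prod.ext (rowD_rowD _ _ _) (Prod.ext (rowD_rowD _ _ _) ?_)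
  change AForm.star c h (AForm.d c p ((rowD c p 1 u.1).2 p)) -
    AForm.scale c _ κ (AForm.d c q ((rowD c q e u.2.1).2 q)) - AForm.Q c (q + 1)
    (AForm.star c h (AForm.d c p (u.1.2 p)) - AForm.scale c _ κ (AForm.d c q (u.2.1.2 q)) -
      AForm.Q c (q + 1) u.2.2) = 0
  rw [d_rowD, d_rowD, map_sub, map_sub, AForm.Q_Q, AForm.star_Q, AForm.scale_Q]
  simp

theorem fieldsD_mem {i : ℤ} {u : Fields c q} (hu : u ∈ fieldsGr c p q i) :
    fieldsD c p q h κ e u ∈ fieldsGr c p q (i + 1) := by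
  obtain ⟨h1, h2, h3⟩ := hu
  refine ⟨rowD_mem p 1 h1, rowD_mem q e h2, ?_⟩
  have a1 := AForm.star_mem h (AForm.d_mem (h1.2.1 p le_rfl))
  have a2 := AForm.scale_mem κ (AForm.d_mem (h2.2.1 q le_rfl))
  have a3 := AForm.Q_mem h3
  rw [show i + p - (p : ℤ) = i + 1 - 1 by ring] at a1
  rw [show i + q - (q : ℤ) = i + 1 - 1 by ring] at a2
  rw [show i - 1 + 1 = i + 1 - 1 by ring] at a3
  exact Submodule.sub_mem (AForm.deg c (q + 1) (i + 1 - 1)) (Submodule.sub_mem _ a1 a2) a3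

variable (c) in
/-- The total differential in degree `i`. -/
def fieldsDGr (i : ℤ) : fieldsGr c p q i →+ fieldsGr c p q (i + 1) :=
  ((fieldsD c p q h κ e).comp (fieldsGr c p q i).subtype).codRestrict _
    fun u => fieldsD_mem p q h κ e u.2

variable (c) in
/-- The cochain complex of sections over a pair of a spacetime and a test object. -/
def complexAt : CochainComplex AddCommGrpCat.{0} ℤ :=
  CochainComplex.of (fun i => AddCommGrpCat.of (fieldsGr c p q i))
    (fun i => AddCommGrpCat.ofHom (fieldsDGr c p q h κ e i))
    (fun i => by
      refine AddCommGrpCat.hom_ext (AddMonoidHom.ext fun u => Subtype.ext ?_)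
      exact fieldsD_fieldsD p q h κ e u.1)

variable {c' c'' : TestedSpacetime s n}

/-- Pull-back of fields. -/
def fieldsPull (f : c ⟶ c') : Fields c' q →+ Fields c q :=
  (rowPull f).prodMap ((rowPull f).prodMap (AForm.pull f (q + 1)).toAddMonoidHom)

theorem fieldsPull_fieldsD (f : c ⟶ c') (u : Fields c' q) :
    fieldsPull q f (fieldsD c' p q h κ e u) = fieldsD c p q h κ e (fieldsPull q f u) := by
  refine Prod.ext (rowPull_rowD _ _ _ _) (Prod.ext (rowPull_rowD _ _ _ _) ?_)
  change AForm.pull f (q + 1) (_ - _ - _) = _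
  rw [map_sub, map_sub, AForm.pull_star, AForm.pull_scale, AForm.pull_Q, AForm.pull_d,
    AForm.pull_d]
  rfl

theorem fieldsPull_mem (f : c ⟶ c') {i : ℤ} {u : Fields c' q} (hu : u ∈ fieldsGr c' p q i) :
    fieldsPull q f u ∈ fieldsGr c p q i :=
  ⟨rowPull_mem f p hu.1, rowPull_mem f q hu.2.1, AForm.pull_mem f hu.2.2⟩

/-- Pull-back of fields in degree `i`. -/
def fieldsPullGr (f : c ⟶ c') (i : ℤ) : fieldsGr c' p q i →+ fieldsGr c p q i :=
  ((fieldsPull q f).comp (fieldsGr c' p q i).subtype).codRestrict _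
    fun u => fieldsPull_mem p q f u.2

variable (s) in
/-- The presheaf of cochain complexes
`ℤ → Ω⁰ → ⋯ → Ωᵖ → Ω^{q+1} ← Ω^q ← ⋯ ← Ω⁰ ← ℤ`, for `n = p + q + 2`. -/
def complexPresheaf : (TestedSpacetime s n)ᵒᵖ ⥤ CochainComplex AddCommGrpCat.{0} ℤ where
  obj c := complexAt c.unop p q h κ e
  map f := CochainComplex.ofHom
    (fun i => AddCommGrpCat.ofHom (fieldsPullGr p q f.unop i))
    (fun i => by
      dsimp only [complexAt]
      rw [CochainComplex.of_d, CochainComplex.of_d]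
      refine AddCommGrpCat.hom_ext (AddMonoidHom.ext fun u => Subtype.ext ?_)
      exact (fieldsPull_fieldsD p q h κ e f.unop u.1).symm)
  map_id c := by
    refine HomologicalComplex.hom_ext _ _ fun i => AddCommGrpCat.hom_ext
      (AddMonoidHom.ext fun u => Subtype.ext ?_)
    exact (Prod.ext (rowPull_id _) (Prod.ext (rowPull_id _) (AForm.pull_id _ _)))
  map_comp f g := by
    refine HomologicalComplex.hom_ext _ _ fun i => AddCommGrpCat.hom_ext
      (AddMonoidHom.ext fun u => Subtype.ext ?_)
    exact (Prod.ext (rowPull_comp _ _ _)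
      (Prod.ext (rowPull_comp _ _ _) (AForm.pull_comp _ _ _ _)))

variable (c) in
/-- Interchange the two rows, rescaled by `1/e` and by `σ/e` (and by `1` and `σ` on the two copies
of `ℤ`), and apply `-(1/(κe)) ⋆` at the right end. -/
def interchange {q q' : ℕ} (h' : n = (q' + 1) + (q + 1)) (κ e : ℝ) (σ : ℤ) (u : Fields c q) :
    Fields c q' :=
  ((u.2.1.1, fun k => AForm.scale c k (1 / e) (u.2.1.2 k)),
    (σ • u.1.1, fun k => AForm.scale c k (σ / e) (u.1.2 k)),
    AForm.scale c (q' + 1) (-(1 / (κ * e))) (AForm.star c h' u.2.2))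

end Complex

end Fields

/-- The charge-discretized `p`-form Maxwell theory with couplings `κ` and `e`, as a presheaf of
cochain complexes on pairs of a spacetime and a test object:
`ℤ → Ω⁰ → ⋯ → Ωᵖ → Ω^{n-p-1} ← Ω^{n-p-2} ← ⋯ ← Ω⁰ ← ℤ`, where `Ωᵖ` and `Ω^{n-p-2}` sit in
degree `0` and map to `Ω^{n-p-1}` by `⋆ d` and `-κ d`, and the two maps `ℤ → Ω⁰` are `1`
and `e`. -/
def MxwCirc (s : SpacetimeKind) (p n : ℕ) (hp : p + 2 ≤ n) (κ e : ℝ) :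
    (TestedSpacetime s n)ᵒᵖ ⥤ CochainComplex AddCommGrpCat.{0} ℤ :=
  complexPresheaf s p (n - p - 2) (by omega) κ e

/-- The components of an element of the complex of the charge-discretized theory. -/
def MxwCirc.val {s : SpacetimeKind} {p n : ℕ} {hp : p + 2 ≤ n} {κ e : ℝ}
    {c : (TestedSpacetime s n)ᵒᵖ} {i : ℤ} (u : ((MxwCirc s p n hp κ e).obj c).X i) :
    Fields c.unop (n - p - 2) :=
  (show fieldsGr c.unop p (n - p - 2) i from u).1

/-! ### Dold-Kan -/

/-- The functor `[-]` from cochain complexes to simplicial abelian groups: the smart truncation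
`⋯ → A⁻² → A⁻¹ → Z(A⁰)`, followed by the Dold-Kan correspondence. -/
def toSimplicialAb : CochainComplex AddCommGrpCat.{0} ℤ ⥤ SimplicialObject AddCommGrpCat.{0} :=
  (ComplexShape.embeddingUpIntLE 0).truncLE'Functor AddCommGrpCat.{0} ⋙
    CategoryTheory.Abelian.DoldKan.equivalence.inverse

/-- The underlying simplicial set of a simplicial abelian group. -/
def forgetSAb : SimplicialObject AddCommGrpCat.{0} ⥤ SSet.{0} :=
  (SimplicialObject.whiskering AddCommGrpCat.{0} (Type)).obj (forget AddCommGrpCat.{0})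

/-! ### Sheaves of spaces -/

/-- Weak homotopy equivalences of simplicial sets: the geometric realization is a homotopy
equivalence. -/
def spaceEquivalences : MorphismProperty SSet.{0} := fun X Y f =>
  ∃ g : C(SSet.toTop.obj Y, SSet.toTop.obj X),
    (g.comp (SSet.toTop.map f).hom).Homotopic (ContinuousMap.id _) ∧
    ((SSet.toTop.map f).hom.comp g).Homotopic (ContinuousMap.id _)

section Stacks

variable (s : SpacetimeKind) (n : ℕ)

/-- Presheaves of simplicial sets on pairs of a spacetime and a test object. -/
abbrev SPresheaf : Type 1 := (TestedSpacetime s n)ᵒᵖ ⥤ SSet.{0}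

/-- Presheaves of simplicial abelian groups on pairs of a spacetime and a test object. -/
abbrev SAbPresheaf : Type 1 := (TestedSpacetime s n)ᵒᵖ ⥤ SimplicialObject AddCommGrpCat.{0}

/-- The objectwise weak equivalences of presheaves. -/
def objectwiseEquivalences : MorphismProperty (SPresheaf s n) := fun _ _ f =>
  ∀ c, spaceEquivalences (f.app c)

/-- The homotopy category of the `∞`-category of presheaves of spaces. -/
abbrev HoPresheaf := (objectwiseEquivalences s n).Localization

variable {s n}

/-- Local trivial fibrations of simplicial presheaves (for instance, a hypercover of an object `c`
is such a map to the presheaf represented by `c`): every lifting problem with respect to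
`∂Δ[m] → Δ[m]` can be solved after restriction to a cover. -/
def IsLocalTrivialFibration {X Y : SPresheaf s n} (f : X ⟶ Y) : Prop :=
  ∀ (m : ℕ) (c : TestedSpacetime s n) (a : (SSet.boundary m : SSet.{0}) ⟶ X.obj (Opposite.op c))
    (b : SSet.stdSimplex.obj (SimplexCategory.mk m) ⟶ Y.obj (Opposite.op c)),
    a ≫ f.app _ = (SSet.boundary m).ι ≫ b →
    ∃ R ∈ siteTopology s n c, ∀ ⦃c' : TestedSpacetime s n⦄ (g : c' ⟶ c), R.arrows g →
      ∃ l : SSet.stdSimplex.obj (SimplexCategory.mk m) ⟶ X.obj (Opposite.op c'),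
        (SSet.boundary m).ι ≫ l = a ≫ X.map g.op ∧ l ≫ f.app _ = b ≫ Y.map g.op

/-- The product of a simplicial set `K` with the presheaf represented by `c`. -/
def tensorRep (K : SSet.{0}) : TestedSpacetime s n ⥤ SPresheaf s n :=
  yoneda ⋙ (Functor.whiskeringRight _ _ _).obj
    ((SimplicialObject.const (Type) : Type ⥤ SSet.{0}) ⋙ MonoidalCategory.tensorLeft K)

/-- A presheaf of spaces is a sheaf valued in derived stacks if it satisfies descent with respect
to hypercovers and sends the equivalences of test objects to equivalences of spaces. Both
conditions say that certain maps `f` induce equivalences on derived mapping spaces to `F`; since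
the maps considered are stable under the product with a simplicial set, it amounts to the same to
say that they induce bijections on morphisms in the homotopy category. -/
def IsStack (F : HoPresheaf s n) : Prop :=
  (∀ {X Y : SPresheaf s n} (f : X ⟶ Y), IsLocalTrivialFibration f →
    Function.Bijective fun g : (objectwiseEquivalences s n).Q.obj Y ⟶ F =>
      (objectwiseEquivalences s n).Q.map f ≫ g) ∧
  (∀ (K : SSet.{0}) {c c' : TestedSpacetime s n} (f : c ⟶ c'), IsTestEquivalence f →
    Function.Bijective fun g : (objectwiseEquivalences s n).Q.obj ((tensorRep K).obj c') ⟶ F =>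
      (objectwiseEquivalences s n).Q.map ((tensorRep K).map f) ≫ g)

variable (s n)

/-- The maps of presheaves which become equivalences after sheafification. -/
def stackEquivalences : MorphismProperty (SPresheaf s n) :=
  (ObjectProperty.isLocal (IsStack (s := s) (n := n))).inverseImage
    (objectwiseEquivalences s n).Q

/-- The homotopy category of the `∞`-category of sheaves on spacetimes (of the given kind and
dimension `n`) valued in derived stacks, as a localization of the category of presheaves of
simplicial sets. An isomorphism in this category is the same as an equivalence in the
`∞`-category. -/
abbrev DerivedStackSheaf := (stackEquivalences s n).Localization

/-- The maps of presheaves of simplicial abelian groups which become equivalences after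
sheafification. -/
def abStackEquivalences : MorphismProperty (SAbPresheaf s n) :=
  (stackEquivalences s n).inverseImage ((Functor.whiskeringRight _ _ _).obj forgetSAb)

/-- The homotopy category of the `∞`-category of sheaves on spacetimes (of the given kind and
dimension `n`) valued in derived abelian group stacks. -/
abbrev DerivedAbStackSheaf := (abStackEquivalences s n).Localization

variable {s n}

/-- The sheaf on spacetimes valued in derived abelian group stacks presented by a presheaf of
cochain complexes. -/
def abStackOf (F : (TestedSpacetime s n)ᵒᵖ ⥤ CochainComplex AddCommGrpCat.{0} ℤ) :
    DerivedAbStackSheaf s n :=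
  (abStackEquivalences s n).Q.obj (F ⋙ toSimplicialAb)

/-- The sheaf on spacetimes valued in derived stacks presented by a presheaf of cochain
complexes. -/
def stackOf (F : (TestedSpacetime s n)ᵒᵖ ⥤ CochainComplex AddCommGrpCat.{0} ℤ) :
    DerivedStackSheaf s n :=
  (stackEquivalences s n).Q.obj (F ⋙ toSimplicialAb ⋙ forgetSAb)

end Stacks

end AbelianDuality

end

/-!
Abelian duality for the charge-discretized Maxwell theory is an identity between cochain complexes:
the interchange of the two rows, rescaled by `1/e` and `σ/e` and completed by `-(1/(κe)) ⋆` on the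
forms of degree `q + 1` at the right end (`q = n - p - 2`), is an isomorphism onto the complex of
the dual theory. Compatibility with the differentials is immediate along the rows. At the right end
it compares `⋆ d C/e - (1/κ) d (σ A/e)` with `-(1/(κe)) ⋆(⋆ d A - κ d C)`, and the two agree exactly
when `⋆⋆ = σ` on forms of degree `p + 1` (`interchange_fieldsD`). The interchange followed by that
of the dual theory is `σ` times the identity, because `⋆⋆` is the same sign `σ` on forms of the
complementary degree `q + 1` (`interchange_interchange`). The isomorphisms of stacks are its images
under the functors that present stacks by complexes.

The substance is therefore the involutivity of the Hodge star up to sign (`starAt_starAt`).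
Naturality of the star under linear changes of coordinates reduces it to a diagonal metric with
entries `±1` and a unit volume form. There, evaluated on basis vectors `e_K`, the form `⋆⋆η` is a
double sum over index tuples `I` and `J` of products `ν(e_J, e_I) ν(e_J, e_K)`; such a product
vanishes unless `J` complements `K` and `I` permutes `K`, and the `m! k!` remaining terms agree
(`sum_onBasis_mul_onBasis`). Passing `m` slots of the volume form past the other `k` contributes the
sign of a block permutation, which depends on the degrees only and is symmetric in them.
-/

noncomputable section

namespace AbelianDuality

/-! ### The square of the Hodge star -/

section StarStar

variable {n m k : ℕ}

/-- The splitting of `n = m + k` slots into the first `k` and the last `m`. -/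
def slots (h : n = m + k) : Fin n ≃ Fin k ⊕ Fin m :=
  (finCongr (h.trans (Nat.add_comm m k))).trans finSumFinEquiv.symm

theorem contract_apply_append (m k : ℕ) (v : Fin k → Euc n) (ν : Alt n (m + k))
    (w : Fin m → Euc n) :
    contract m k v ν w = ν (fun i => Fin.append v w (Fin.cast (Nat.add_comm m k) i)) := by
  induction k with
  | zero =>
    rw [Fin.append_left_nil _ _ rfl]
    rfl
  | succ k ih =>
    refine (ih (Fin.tail v) (ContinuousAlternatingMap.curryLeft (n := m + k) ν (v 0))).trans ?_
    refine congrArg ν ?_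
    conv_rhs => rw [← Fin.cons_self_tail v, Fin.append_cons]
    funext i
    refine Fin.cases rfl (fun j => ?_) i
    rfl

theorem contract_castDeg_apply {l : ℕ} (h : l = m + k) (v : Fin k → Euc n) (ν : Alt n l)
    (w : Fin m → Euc n) :
    contract m k v (castDeg h ν) w = ν (fun i => Sum.elim v w (slots h i)) := by
  subst h
  rw [contract_apply_append]
  refine congrArg ν (funext fun i => ?_)
  change _ = Sum.elim v w (finSumFinEquiv.symm (Fin.cast (Nat.add_comm m k) i))
  refine Fin.addCases (fun j => ?_) (fun j => ?_) (Fin.cast (Nat.add_comm m k) i) <;> simp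

/-- The permutation of the slots that moves a last block of `m` slots past a first block of `k`
slots. -/
def blockSwap (h : n = m + k) (h' : n = k + m) : Equiv.Perm (Fin n) :=
  (slots h').trans ((Equiv.sumComm _ _).trans (slots h).symm)

theorem sign_blockSwap_comm (h : n = m + k) (h' : n = k + m) :
    Equiv.Perm.sign (blockSwap h' h) = Equiv.Perm.sign (blockSwap h h') := by
  have : blockSwap h' h = (blockSwap h h')⁻¹ := Equiv.ext fun i => rfl
  rw [this, Equiv.Perm.sign_inv]

theorem apply_slots_swap (h : n = m + k) (h' : n = k + m) (ν : Alt n n) (v : Fin k → Euc n)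
    (w : Fin m → Euc n) :
    ν (fun i => Sum.elim v w (slots h i)) =
      (Equiv.Perm.sign (blockSwap h h') : ℤ) * ν (fun i => Sum.elim w v (slots h' i)) := by
  have h1 := ν.toAlternatingMap.map_perm (fun i => Sum.elim v w (slots h i)) (blockSwap h h')
  have h2 : (fun i => Sum.elim v w (slots h i)) ∘ blockSwap h h' =
      fun i => Sum.elim w v (slots h' i) := by
    funext i
    simp only [blockSwap, Function.comp_apply, Equiv.trans_apply, Equiv.apply_symm_apply]
    cases slots h' i <;> rfl
  rw [h2] at h1
  have h3 : ν (fun i => Sum.elim w v (slots h' i)) =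
      (Equiv.Perm.sign (blockSwap h h') : ℤ) * ν (fun i => Sum.elim v w (slots h i)) := by
    rw [← zsmul_eq_mul]
    exact h1
  rw [h3, ← mul_assoc, ← Int.cast_mul, Int.units_coe_mul_self, Int.cast_one, one_mul]

/-- The value of a top degree form on basis vectors, labelled by a set `ι` in bijection with the
slots. -/
def onBasis {ι : Type} (b : Fin n ≃ ι) (ν : Alt n n) (F : ι → Fin n) : ℝ :=
  ν (fun i => stdVec (F (b i)))

section onBasis

variable {ι : Type} (b : Fin n ≃ ι) (ν : Alt n n)

theorem onBasis_perm [Fintype ι] [DecidableEq ι] (F : ι → Fin n) (π : Equiv.Perm ι) :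
    onBasis b ν (F ∘ π) = (Equiv.Perm.sign π : ℤ) * onBasis b ν F := by
  have h1 := ν.toAlternatingMap.map_perm (fun i => stdVec (F (b i)))
    ((b.trans π).trans b.symm)
  have h2 : (fun i => stdVec (F (b i))) ∘ ((b.trans π).trans b.symm) =
      fun i => (stdVec ((F ∘ π) (b i)) : Euc n) := by
    funext i
    simp
  have h3 : Equiv.Perm.sign ((b.trans π).trans b.symm) = Equiv.Perm.sign π :=
    Equiv.Perm.sign_trans_trans_symm π b
  rw [h2, h3] at h1
  rw [← zsmul_eq_mul]
  exact h1

theorem injective_of_onBasis_ne_zero {F : ι → Fin n} (hF : onBasis b ν F ≠ 0) :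
    Function.Injective F := by
  intro i j hij
  by_contra hne
  refine hF (ν.map_eq_zero_of_eq _ (i := b.symm i) (j := b.symm j) ?_ ?_)
  · simp [hij]
  · simpa using hne

theorem onBasis_sq {F : ι → Fin n} (hF : Function.Bijective F) :
    onBasis b ν F ^ 2 = ν stdVec ^ 2 := by
  have h1 := ν.toAlternatingMap.map_perm stdVec (b.trans (Equiv.ofBijective F hF))
  have h2 : onBasis b ν F =
      (Equiv.Perm.sign (b.trans (Equiv.ofBijective F hF)) : ℤ) * ν stdVec := by
    rw [← zsmul_eq_mul]
    exact h1
  rw [h2, mul_pow, ← Int.cast_pow, ← Units.val_pow_eq_pow_val, Int.units_sq]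
  simp

end onBasis

/-- An injective tuple of `k` indices is completed to all of `Fin (m + k)`. -/
theorem exists_complement (h' : n = k + m) {K : Fin k → Fin n} (hK : Function.Injective K) :
    ∃ J : Fin m → Fin n, Function.Bijective (Sum.elim J K) := by
  classical
  have hc : Fintype.card (Fin m) = Fintype.card ((Set.range K)ᶜ : Set (Fin n)) := by
    rw [Fintype.card_compl_set, Set.card_range_of_injective hK]
    simp [h']
  let E := Fintype.equivOfCardEq hc
  refine ⟨fun i => (E i : Fin n), (Fintype.bijective_iff_injective_and_card _).2 ⟨?_, ?_⟩⟩
  · refine Function.Injective.sumElim (Subtype.val_injective.comp E.injective) hK fun a b hab => ?_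
    exact (E a).2 ⟨b, hab.symm⟩
  · simp [h', Nat.add_comm]

/-- If two tuples both complement `K`, then they differ by a permutation. -/
theorem exists_perm_of_complements {A B C : Type} [Finite A] {J₀ J : A → C} {K : B → C}
    (h₀ : Function.Surjective (Sum.elim J₀ K)) (hJ : Function.Injective (Sum.elim J K)) :
    ∃ a : Equiv.Perm A, J₀ ∘ a = J := by
  have hx : ∀ i, ∃ j, J₀ j = J i := fun i => by
    obtain ⟨j | j, hj⟩ := h₀ (J i)
    · exact ⟨j, hj⟩
    · have : (Sum.inr j : A ⊕ B) = Sum.inl i := hJ hj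
      cases this
  choose a ha using hx
  have hinj : Function.Injective a := fun i j hij => by
    have : (Sum.inl i : A ⊕ B) = Sum.inl j :=
      hJ (by rw [Sum.elim_inl, Sum.elim_inl, ← ha, hij, ha])
    exact Sum.inl_injective this
  exact ⟨Equiv.ofBijective a (Finite.injective_iff_bijective.1 hinj), funext ha⟩

/-- The contraction of two volume forms in `m` slots is the generalized Kronecker symbol: in the
double sum only those index tuples contribute which complement `K` and permute `K`, respectively;
all `m! k!` contributions agree. -/
theorem sum_onBasis_mul_onBasis (h' : n = k + m) (ε : Fin n → ℝ) (ν : Alt n n) (η : Alt n k)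
    {K : Fin k → Fin n} (hK : Function.Injective K) :
    ∑ J : Fin m → Fin n, ∑ I : Fin k → Fin n, (∏ a, ε (J a)) * (∏ a, ε (I a)) *
        η (fun a => stdVec (I a)) * onBasis (slots h') ν (Sum.elim J I) *
        onBasis (slots h') ν (Sum.elim J K) =
      m.factorial * k.factorial * (∏ i, ε i) * ν stdVec ^ 2 * η (fun a => stdVec (K a)) := by
  classical
  obtain ⟨J₀, hJ₀⟩ := exists_complement h' hK
  rw [← Fintype.sum_prod_type']
  have hη : ∀ b : Equiv.Perm (Fin k), η (fun a => stdVec (K (b a))) =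
      (Equiv.Perm.sign b : ℤ) * η (fun a => stdVec (K a)) := fun b => by
    rw [← zsmul_eq_mul]
    exact η.toAlternatingMap.map_perm (fun a => stdVec (K a)) b
  have hε : (∏ a, ε (J₀ a)) * (∏ a, ε (K a)) = ∏ i, ε i := by
    rw [← (Equiv.ofBijective _ hJ₀).prod_comp, Fintype.prod_sum_type]
    rfl
  have hcomp : ∀ (a : Equiv.Perm (Fin m)) (b : Equiv.Perm (Fin k)),
      Sum.elim (J₀ ∘ a) (K ∘ b) = Sum.elim J₀ K ∘ Equiv.Perm.sumCongr a b := fun a b => by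
    funext x
    cases x <;> rfl
  have hcomp' : ∀ a : Equiv.Perm (Fin m),
      Sum.elim (J₀ ∘ a) K = Sum.elim J₀ K ∘ Equiv.Perm.sumCongr a 1 := fun a => hcomp a 1
  have hsq : ∀ π : ℤˣ, ((π : ℤ) : ℝ) * ((π : ℤ) : ℝ) = 1 := fun π => by
    rw [← Int.cast_mul, Int.units_coe_mul_self, Int.cast_one]
  symm
  calc _ = ∑ _x : Equiv.Perm (Fin m) × Equiv.Perm (Fin k),
        (∏ i, ε i) * ν stdVec ^ 2 * η (fun a => stdVec (K a)) := by
        rw [Finset.sum_const, Finset.card_univ, Fintype.card_prod, Fintype.card_perm,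
          Fintype.card_perm, Fintype.card_fin, Fintype.card_fin, nsmul_eq_mul]
        push_cast
        ring
    _ = _ := by
        -- The tuples that contribute are the images of pairs of permutations of `J₀` and of `K`.
        refine Finset.sum_of_injOn (fun x => (J₀ ∘ x.1, K ∘ x.2)) ?_
          (fun _ _ => Finset.mem_coe.2 (Finset.mem_univ _)) ?_ ?_
        · rintro ⟨a, b⟩ - ⟨a', b'⟩ - hab
          obtain ⟨h1, h2⟩ := Prod.ext_iff.1 hab
          refine Prod.ext (Equiv.ext fun i => ?_) (Equiv.ext fun i => ?_)
          · exact Sum.inl_injective (hJ₀.1 (congrFun h1 i))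
          · exact hK (congrFun h2 i)
        · rintro ⟨J, I⟩ - hJI
          by_contra hne
          have h1 := injective_of_onBasis_ne_zero _ _ (right_ne_zero_of_mul hne)
          have h2 := injective_of_onBasis_ne_zero _ _
            (right_ne_zero_of_mul (left_ne_zero_of_mul hne))
          obtain ⟨a, rfl⟩ := exists_perm_of_complements hJ₀.2 h1
          have h3 : Function.Surjective (Sum.elim K (J₀ ∘ a)) := fun x => by
            obtain ⟨j | j, hj⟩ := hJ₀.2 x
            · exact ⟨Sum.inr (a.symm j), by simpa using hj⟩
            · exact ⟨Sum.inl j, hj⟩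
          have h4 : Function.Injective (Sum.elim I (J₀ ∘ a)) := by
            have : Sum.elim I (J₀ ∘ a) = Sum.elim (J₀ ∘ a) I ∘ Equiv.sumComm _ _ := by
              funext x
              cases x <;> rfl
            rw [this]
            exact h2.comp (Equiv.injective _)
          obtain ⟨b, rfl⟩ := exists_perm_of_complements h3 h4
          exact hJI ⟨(a, b), Finset.mem_coe.2 (Finset.mem_univ _), rfl⟩
        · rintro ⟨a, b⟩ -
          have e1 : ∏ i, ε ((J₀ ∘ a) i) = ∏ i, ε (J₀ i) := Equiv.prod_comp a fun i => ε (J₀ i)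
          have e2 : ∏ i, ε ((K ∘ b) i) = ∏ i, ε (K i) := Equiv.prod_comp b fun i => ε (K i)
          dsimp only
          rw [e1, e2, hε, hcomp, hcomp', onBasis_perm, onBasis_perm, Equiv.Perm.sign_sumCongr,
            Equiv.Perm.sign_sumCongr, Equiv.Perm.sign_one, mul_one, ← onBasis_sq (slots h') ν hJ₀]
          simp only [Function.comp_apply, hη]
          have ha := hsq (Equiv.Perm.sign a)
          have hb := hsq (Equiv.Perm.sign b)
          push_cast
          set A : ℝ := ((Equiv.Perm.sign a : ℤ) : ℝ)
          set B : ℝ := ((Equiv.Perm.sign b : ℤ) : ℝ)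
          calc _ = (A * A) * (B * B) * ((∏ i, ε i) * onBasis (slots h') ν (Sum.elim J₀ K) ^ 2 *
                η (fun a => stdVec (K a))) := by rw [ha, hb]; ring
            _ = _ := by ring

/-- The Hodge star for a diagonal metric with entries `±1`. -/
theorem starAt_diagonal_apply (h : n = m + k) {ε : Fin n → ℝ} (hε : ∀ i, ε i * ε i = 1)
    (ν : Alt n n) (η : Alt n k) (w : Fin m → Euc n) :
    starAt h (Matrix.diagonal ε) ν η w = (k.factorial : ℝ)⁻¹ * ∑ I : Fin k → Fin n,
      (∏ a, ε (I a)) * η (fun a => stdVec (I a)) *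
        ν (fun i => Sum.elim (fun a => stdVec (I a)) w (slots h i)) := by
  have hinv : (Matrix.diagonal ε)⁻¹ = Matrix.diagonal ε := by
    refine Matrix.inv_eq_right_inv ?_
    rw [Matrix.diagonal_mul_diagonal, ← Matrix.diagonal_one]
    exact congrArg _ (funext hε)
  unfold starAt
  rw [hinv, ContinuousAlternatingMap.smul_apply, smul_eq_mul, ContinuousAlternatingMap.sum_apply]
  congr 1
  refine Finset.sum_congr rfl fun I _ => ?_
  rw [ContinuousAlternatingMap.sum_apply, Finset.sum_eq_single I]
  · rw [ContinuousAlternatingMap.smul_apply, smul_eq_mul, contract_castDeg_apply]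
    simp
  · intro J _ hJ
    obtain ⟨a, ha⟩ := Function.ne_iff.1 hJ
    have h0 : ∏ a, Matrix.diagonal ε (I a) (J a) = 0 :=
      Finset.prod_eq_zero (Finset.mem_univ a) (Matrix.diagonal_apply_ne ε ha.symm)
    rw [h0, zero_mul, zero_smul]
    rfl
  · simp

theorem Alt.ext_stdVec {η ζ : Alt n k} (H : ∀ K : Fin k → Fin n, Function.Injective K →
    η (fun a => stdVec (K a)) = ζ (fun a => stdVec (K a))) : η = ζ := by
  refine ContinuousAlternatingMap.toAlternatingMap_injective
    ((EuclideanSpace.basisFun (Fin n) ℝ).toBasis.ext_alternating fun K hK => ?_)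
  simpa [stdVec] using H K hK

theorem starAt_starAt_diagonal (h : n = m + k) (h' : n = k + m) {ε : Fin n → ℝ}
    (hε : ∀ i, ε i * ε i = 1) {ν : Alt n n} (hν : ν stdVec ^ 2 = 1) (η : Alt n k) :
    starAt h' (Matrix.diagonal ε) ν (starAt h (Matrix.diagonal ε) ν η) =
      ((Equiv.Perm.sign (blockSwap h h') : ℤ) * ∏ i, ε i : ℝ) • η := by
  refine Alt.ext_stdVec fun K hK => ?_
  have hel : ∀ {A B : Type} (J : A → Fin n) (I : B → Fin n) (x : A ⊕ B),
      Sum.elim (fun a => (stdVec (J a) : Euc n)) (fun a => stdVec (I a)) x =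
        stdVec (Sum.elim J I x) := fun J I x => by cases x <;> rfl
  have key := sum_onBasis_mul_onBasis h' ε ν η hK
  rw [hν, mul_one] at key
  rw [starAt_diagonal_apply h' hε, ContinuousAlternatingMap.smul_apply, smul_eq_mul]
  simp_rw [starAt_diagonal_apply h hε, apply_slots_swap h h', hel]
  have hm : (m.factorial : ℝ) ≠ 0 := by positivity
  have hk : (k.factorial : ℝ) ≠ 0 := by positivity
  set S : ℝ := ((Equiv.Perm.sign (blockSwap h h') : ℤ) : ℝ)
  calc _ = (m.factorial : ℝ)⁻¹ * ((k.factorial : ℝ)⁻¹ * (S *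
        ∑ J : Fin m → Fin n, ∑ I : Fin k → Fin n, (∏ a, ε (J a)) * (∏ a, ε (I a)) *
        η (fun a => stdVec (I a)) * onBasis (slots h') ν (Sum.elim J I) *
        onBasis (slots h') ν (Sum.elim J K))) := by
        simp only [Finset.mul_sum, Finset.sum_mul]
        refine Finset.sum_congr rfl fun J _ => Finset.sum_congr rfl fun I _ => ?_
        simp only [onBasis]
        ring
    _ = _ := by
        rw [key]
        field_simp

theorem matOf_toEuclideanCLM (P : Matrix (Fin n) (Fin n) ℝ) :
    matOf (Matrix.toEuclideanCLM (n := Fin n) (𝕜 := ℝ) P) = P := by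
  ext i j
  simp [matOf, stdVec]

theorem apply_comp_stdVec (ν : Alt n n) (L : Euc n →L[ℝ] Euc n) :
    ν.compContinuousLinearMap L stdVec = (matOf L).det * ν stdVec := by
  set B := (EuclideanSpace.basisFun (Fin n) ℝ).toBasis
  have hB : (stdVec : Fin n → Euc n) = B := by
    funext i
    simp [B, stdVec]
  have h1 := congrArg (fun f => f fun j => L (stdVec j)) (ν.toAlternatingMap.eq_smul_basis_det B)
  have h2 : B.toMatrix (fun j => L (stdVec j)) = matOf L := by
    ext i j
    simp [B, Module.Basis.toMatrix_apply, matOf]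
  change ν (fun j => L (stdVec j)) = ν B * B.det (fun j => L (stdVec j)) at h1
  rw [Module.Basis.det_apply, h2, ← hB] at h1
  exact h1.trans (mul_comm _ _)

theorem SpacetimeKind.eta_mul_self (s : SpacetimeKind) (n : ℕ) (i : Fin n) :
    s.eta n i * s.eta n i = 1 := by
  unfold SpacetimeKind.eta
  cases s with
  | riemannian => simp
  | lorentzian => dsimp only; split_ifs <;> norm_num

theorem SpacetimeKind.prod_eta_eq_or (s : SpacetimeKind) (n : ℕ) :
    (∏ i, s.eta n i = 1) ∨ (∏ i, s.eta n i = -1) := by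
  rw [← mul_self_eq_one_iff, ← Finset.prod_mul_distrib]
  exact Finset.prod_eq_one fun i _ => s.eta_mul_self n i

/-- The sign of the square of the Hodge star on `k`-forms in dimension `n = m + k`: the sign of the
exchange of `m` and `k` slots, times the sign of the determinant of the metric. -/
def starSign (s : SpacetimeKind) (h : n = m + k) (h' : n = k + m) : ℝ :=
  (Equiv.Perm.sign (blockSwap h h') : ℤ) * ∏ i, s.eta n i

theorem starSign_comm (s : SpacetimeKind) (h : n = m + k) (h' : n = k + m) :
    starSign s h' h = starSign s h h' := by
  rw [starSign, starSign, sign_blockSwap_comm]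

theorem exists_int_eq_starSign (s : SpacetimeKind) (h : n = m + k) (h' : n = k + m) :
    ∃ σ : ℤ, (σ = 1 ∨ σ = -1) ∧ (σ : ℝ) = starSign s h h' := by
  unfold starSign
  rcases Int.units_eq_one_or (Equiv.Perm.sign (blockSwap h h')) with h1 | h1 <;>
    rcases s.prod_eta_eq_or n with h2 | h2 <;> rw [h1, h2]
  · exact ⟨1, Or.inl rfl, by simp⟩
  · exact ⟨-1, Or.inr rfl, by simp⟩
  · exact ⟨-1, Or.inr rfl, by simp⟩
  · exact ⟨1, Or.inl rfl, by simp⟩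

/-- The general case follows from that of a diagonal metric, by naturality of the star under the
change to an orthonormal basis. -/
theorem starAt_starAt (s : SpacetimeKind) (h : n = m + k) (h' : n = k + m)
    {G P : Matrix (Fin n) (Fin n) ℝ} (hP : IsUnit P.det)
    (hG : P.transpose * G * P = Matrix.diagonal (s.eta n)) {ν : Alt n n}
    (hν : ν stdVec ^ 2 = |G.det|) (η : Alt n k) :
    starAt h' G ν (starAt h G ν η) = starSign s h h' • η := by
  set L := Matrix.toEuclideanCLM (n := Fin n) (𝕜 := ℝ) P with hL
  set L' := Matrix.toEuclideanCLM (n := Fin n) (𝕜 := ℝ) P⁻¹ with hL'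
  have hPL : matOf L = P := matOf_toEuclideanCLM P
  have hLL : L.comp L' = ContinuousLinearMap.id ℝ _ := by
    change L * L' = 1
    rw [hL, hL', ← map_mul, Matrix.mul_nonsing_inv P hP, map_one]
  have hηdet : |(Matrix.diagonal (s.eta n)).det| = 1 := by
    rw [Matrix.det_diagonal]
    rcases s.prod_eta_eq_or n with h2 | h2 <;> rw [h2] <;> simp
  have hdet : ((matOf L).transpose * G * matOf L).det ≠ 0 := by
    rw [hPL, hG]
    exact abs_ne_zero.1 (hηdet ▸ one_ne_zero)
  have hνL : ν.compContinuousLinearMap L stdVec ^ 2 = 1 := by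
    rw [apply_comp_stdVec, hPL, mul_pow, hν, ← hηdet, ← hG, Matrix.det_mul, Matrix.det_mul,
      Matrix.det_transpose, abs_mul, abs_mul, ← sq_abs P.det]
    ring
  have h1 := starAt_starAt_diagonal h h' (s.eta_mul_self n) hνL (η.compContinuousLinearMap L)
  rw [← hG, ← hPL, starAt_comp h G ν η L hdet, starAt_comp h' G ν _ L hdet] at h1
  have h2 := congrArg (fun ζ : Alt n k => ζ.compContinuousLinearMap L') h1
  have h3 : ∀ ζ : Alt n k, (ζ.compContinuousLinearMap L).compContinuousLinearMap L' = ζ := by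
    intro ζ
    ext v
    exact congrArg ζ (funext fun i => DFunLike.congr_fun hLL (v i))
  rw [← h3 (starAt h' G ν (starAt h G ν η)), h2]
  exact congrArg (starSign s h h' • ·) (h3 η)

end StarStar


/-! ### The Hodge star and rescalings on forms -/

section FormOperations

variable {s : SpacetimeKind} {n m k : ℕ}

theorem Form.star_star (M : Spacetime s n) {N : ℕ} {X : Type} [TopologicalSpace X]
    [ChartedSpace (Euc N) X] (h : n = m + k) (h' : n = k + m) {σ : ℤ} (hσ : σ = 1 ∨ σ = -1)
    (hs : (σ : ℝ) = starSign s h h') (α : Form n M.carrier N X k) :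
    Form.star M h' (Form.star M h α) = σ • α := by
  refine Form.ext fun c y hy x => ?_
  have h1 : (σ • α).1 c y x = (σ : ℝ) • α.1 c y x := by
    rcases hσ with rfl | rfl
    · rw [one_smul, Int.cast_one, one_smul]
    · rw [neg_one_smul, Int.cast_neg, Int.cast_one]
      exact (neg_one_smul ℝ (α.1 c y x)).symm
  obtain ⟨P, hP, hG⟩ := M.metric_signature c y hy
  rw [h1, hs, ← starAt_starAt s h h' hP hG (M.vol_sq c y hy)]
  refine (Form.starFun_apply M h' _ c hy x).trans ?_
  exact congrArg _ (Form.starFun_apply M h α c hy x)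

namespace AForm

variable {c : TestedSpacetime s n}

theorem star_star (h : n = m + k) (h' : n = k + m) {σ : ℤ} (hσ : σ = 1 ∨ σ = -1)
    (hs : (σ : ℝ) = starSign s h h') (v : AForm c k) : star c h' (star c h v) = σ • v := by
  induction v using TensorProduct.induction_on with
  | zero => simp
  | tmul α a =>
    rw [star, star, LinearMap.rTensor_tmul, LinearMap.rTensor_tmul,
      Form.star_star c.1 h h' hσ hs, TensorProduct.smul_tmul']
  | add x y hx hy => rw [map_add, map_add, hx, hy, smul_add]

theorem scale_scale (r r' : ℝ) (v : AForm c k) :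
    scale c k r (scale c k r' v) = scale c k (r * r') v := by
  change algebraMap ℝ c.2.Fn r • algebraMap ℝ c.2.Fn r' • v = algebraMap ℝ c.2.Fn (r * r') • v
  rw [map_mul, mul_smul]

theorem scale_one (v : AForm c k) : scale c k 1 v = v := by
  change algebraMap ℝ c.2.Fn 1 • v = v
  rw [map_one, one_smul]

theorem scale_neg (r : ℝ) (v : AForm c k) : scale c k (-r) v = -scale c k r v := by
  change algebraMap ℝ c.2.Fn (-r) • v = -(algebraMap ℝ c.2.Fn r • v)
  rw [map_neg, neg_smul]

theorem scale_intCast (σ : ℤ) (v : AForm c k) : scale c k σ v = σ • v := by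
  change algebraMap ℝ c.2.Fn σ • v = σ • v
  rw [map_intCast, Int.cast_smul_eq_zsmul]

theorem scale_d (r : ℝ) (v : AForm c k) : d c k (scale c k r v) = scale c (k + 1) r (d c k v) :=
  (d c k).map_smul _ v

theorem scale_star (h : n = m + k) (r : ℝ) (v : AForm c k) :
    star c h (scale c k r v) = scale c m r (star c h v) := (star c h).map_smul _ v

theorem scale_ofInt (r m : ℝ) (z : IntFn c) : scale c 0 r (ofInt c m z) = ofInt c (r * m) z := by
  change algebraMap ℝ c.2.Fn r • (Form.ofInt m z ⊗ₜ[c.2.Fn] (1 : c.2.alg)) =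
    Form.ofInt (r * m) z ⊗ₜ[c.2.Fn] (1 : c.2.alg)
  rw [TensorProduct.smul_tmul']
  congr 1
  refine Form.ext fun C y hy x => ?_
  rw [Form.smul_apply, Form.ofInt_apply _ _ C hy, Form.ofInt_apply _ _ C hy]
  ext v
  exact (mul_assoc r m _).symm

end AForm

end FormOperations

/-! ### The interchange of the two rows -/

section Interchange

variable {s : SpacetimeKind} {n : ℕ} (c : TestedSpacetime s n)

/-- Multiplication of the forms of a row by the real number `r` and of the locally constant
functions by the integer `σ`. -/
def rowScale (σ : ℤ) (r : ℝ) : Row c →+ Row c where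
  toFun u := (σ • u.1, fun k => AForm.scale c k r (u.2 k))
  map_zero' := Prod.ext (smul_zero σ) (funext fun k => map_zero (AForm.scale c k r))
  map_add' _ _ := Prod.ext (smul_add σ _ _) (funext fun k => map_add (AForm.scale c k r) _ _)

variable {c}

theorem rowScale_rowD (p : ℕ) {m m' r : ℝ} {σ : ℤ} (hm : m' * σ = r * m) (u : Row c) :
    rowScale c σ r (rowD c p m u) = rowD c p m' (rowScale c σ r u) := by
  refine Prod.ext (smul_zero σ) (funext fun k => ?_)
  change AForm.scale c k r ((rowD c p m u).2 k) = _
  cases k with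
  | zero =>
    have h1 : AForm.ofInt c m' (σ • u.1) = AForm.ofInt c (r * m) u.1 := by
      rw [map_zsmul, ← AForm.scale_intCast, AForm.scale_ofInt, ← hm, mul_comm]
    rw [rowD_zero, rowD_zero, map_add, map_zsmul, AForm.scale_ofInt, AForm.scale_Q, ← h1]
    rfl
  | succ k =>
    rw [rowD_succ, rowD_succ]
    split_ifs
    · rw [map_add, map_zsmul, AForm.scale_Q, ← AForm.scale_d]
      rfl
    · exact map_zero _

theorem rowScale_mem (p : ℕ) {i : ℤ} (σ : ℤ) (r : ℝ) {u : Row c} (hu : u ∈ rowGr c p i) :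
    rowScale c σ r u ∈ rowGr c p i := by
  refine ⟨fun hi => ?_, fun k hk => AForm.scale_mem r (hu.2.1 k hk), fun k hk => ?_⟩
  · change σ • u.1 = 0
    rw [hu.1 hi, smul_zero]
  · change AForm.scale c k r (u.2 k) = 0
    rw [hu.2.2 k hk, map_zero]

theorem rowScale_rowScale {σ τ ρ : ℤ} {r t : ℝ} (h1 : σ * τ = ρ) (h2 : r * t = ρ) (u : Row c) :
    rowScale c σ r (rowScale c τ t u) = ρ • u := by
  refine Prod.ext ?_ (funext fun k => ?_)
  · change σ • τ • u.1 = ρ • u.1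
    rw [smul_smul, h1]
  · change AForm.scale c k r (AForm.scale c k t (u.2 k)) = ρ • u.2 k
    rw [AForm.scale_scale, h2, AForm.scale_intCast]

theorem rowScale_rowPull {c' : TestedSpacetime s n} (f : c ⟶ c') (σ : ℤ) (r : ℝ) (u : Row c') :
    rowScale c σ r (rowPull f u) = rowPull f (rowScale c' σ r u) :=
  Prod.ext (map_zsmul (AForm.pullInt f) σ _).symm
    (funext fun k => (AForm.pull_scale f k r _).symm)

variable {p q : ℕ} (h : n = (q + 1) + (p + 1)) (h' : n = (p + 1) + (q + 1)) (κ e : ℝ) (σ : ℤ)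

theorem interchange_eq (u : Fields c q) : interchange c h' κ e σ u =
    (rowScale c 1 (1 / e) u.2.1, rowScale c σ (σ / e) u.1,
      AForm.scale c (p + 1) (-(1 / (κ * e))) (AForm.star c h' u.2.2)) :=
  Prod.ext (Prod.ext (one_smul ℤ _).symm rfl) rfl

variable (c) in
/-- The interchange of the rows as a homomorphism. -/
def interchangeHom : Fields c q →+ Fields c p where
  toFun := interchange c h' κ e σ
  map_zero' := by
    rw [interchange_eq]
    simp
  map_add' u v := by
    simp only [interchange_eq, Prod.fst_add, Prod.snd_add, map_add]
    rfl

theorem interchange_mem {i : ℤ} {u : Fields c q} (hu : u ∈ fieldsGr c p q i) :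
    interchange c h' κ e σ u ∈ fieldsGr c q p i := by
  rw [interchange_eq]
  exact ⟨rowScale_mem q _ _ hu.2.1, rowScale_mem p _ _ hu.1,
    AForm.scale_mem _ (AForm.star_mem h' hu.2.2)⟩

theorem interchange_fieldsPull {c' : TestedSpacetime s n} (f : c ⟶ c') (u : Fields c' q) :
    interchange c h' κ e σ (fieldsPull q f u) = fieldsPull p f (interchange c' h' κ e σ u) := by
  rw [interchange_eq, interchange_eq]
  refine Prod.ext (rowScale_rowPull f _ _ _) (Prod.ext (rowScale_rowPull f _ _ _) ?_)
  change AForm.scale c _ _ (AForm.star c h' (AForm.pull f _ u.2.2)) =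
    AForm.pull f _ (AForm.scale c' _ _ (AForm.star c' h' u.2.2))
  rw [AForm.pull_scale, AForm.pull_star]

variable {κ e σ}

/-- The interchange is compatible with the differentials. In the component of degree one, this is
where the sign `σ` of `⋆⋆` on `(p + 1)`-forms enters: `⋆(⋆ d A) = σ d A`. -/
theorem interchange_fieldsD (hκ : κ ≠ 0) (he : e ≠ 0) (hσ : σ = 1 ∨ σ = -1)
    (hs : (σ : ℝ) = starSign s h h') (u : Fields c q) :
    interchange c h' κ e σ (fieldsD c p q h κ e u) =
      fieldsD c q p h' (1 / κ) (1 / e) (interchange c h' κ e σ u) := by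
  rw [interchange_eq, interchange_eq]
  refine Prod.ext (rowScale_rowD q ?_ u.2.1) (Prod.ext (rowScale_rowD p ?_ u.1) ?_)
  · field_simp
    simp
  · ring
  change AForm.scale c (p + 1) (-(1 / (κ * e))) (AForm.star c h'
      (AForm.star c h (AForm.d c p (u.1.2 p)) - AForm.scale c _ κ (AForm.d c q (u.2.1.2 q)) -
        AForm.Q c (q + 1) u.2.2)) =
    AForm.star c h' (AForm.d c q (AForm.scale c q (1 / e) (u.2.1.2 q))) -
      AForm.scale c _ (1 / κ) (AForm.d c p (AForm.scale c p (σ / e) (u.1.2 p))) -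
      AForm.Q c (p + 1) (AForm.scale c (p + 1) (-(1 / (κ * e))) (AForm.star c h' u.2.2))
  rw [map_sub, map_sub, map_sub, map_sub, AForm.star_star h h' hσ hs, AForm.star_Q,
    AForm.scale_star, AForm.scale_scale, ← AForm.scale_intCast, AForm.scale_scale, AForm.scale_Q,
    AForm.scale_d, AForm.scale_star, AForm.scale_d, AForm.scale_scale,
    show -(1 / (κ * e)) * (σ : ℝ) = -(1 / κ * (σ / e)) by field_simp,
    show -(1 / (κ * e)) * κ = -(1 / e) by field_simp, AForm.scale_neg, AForm.scale_neg]
  abel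

/-- The interchange for the theory and for its dual are inverse up to the sign `σ`. -/
theorem interchange_interchange (hκ : κ ≠ 0) (he : e ≠ 0) (hσ : σ = 1 ∨ σ = -1)
    (hs : (σ : ℝ) = starSign s h h') (u : Fields c q) :
    interchange c h (1 / κ) (1 / e) σ (interchange c h' κ e σ u) = σ • u := by
  rw [interchange_eq, interchange_eq]
  refine Prod.ext (rowScale_rowScale (one_mul σ) ?_ u.1)
    (Prod.ext (rowScale_rowScale (mul_one σ) ?_ u.2.1) ?_)
  · field_simp
  · field_simp
  change AForm.scale c (q + 1) (-(1 / (1 / κ * (1 / e)))) (AForm.star c h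
    (AForm.scale c (p + 1) (-(1 / (κ * e))) (AForm.star c h' u.2.2))) = σ • u.2.2
  rw [AForm.scale_star, AForm.star_star h' h hσ (hs.trans (starSign_comm s h' h)),
    AForm.scale_scale,
    show -(1 / (1 / κ * (1 / e))) * -(1 / (κ * e)) = 1 by field_simp, AForm.scale_one]

end Interchange

/-! ### The isomorphism of presheaves of complexes -/

section Duality

variable {s : SpacetimeKind} {n p q : ℕ} (h : n = (q + 1) + (p + 1))
  (h' : n = (p + 1) + (q + 1)) {κ e : ℝ} {σ : ℤ}

/-- The interchange of the rows in degree `i`; its inverse is `σ` times the interchange of the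
dual theory. -/
def interchangeEquiv (c : TestedSpacetime s n) (hκ : κ ≠ 0) (he : e ≠ 0) (hσ : σ = 1 ∨ σ = -1)
    (hs : (σ : ℝ) = starSign s h h') (i : ℤ) : fieldsGr c p q i ≃+ fieldsGr c q p i :=
  have hσσ : σ * σ = 1 := by rcases hσ with rfl | rfl <;> rfl
  { toFun := fun u => ⟨interchangeHom c h' κ e σ u.1, interchange_mem h' κ e σ u.2⟩
    invFun := fun u => ⟨σ • interchangeHom c h (1 / κ) (1 / e) σ u.1,
      zsmul_mem (interchange_mem h (1 / κ) (1 / e) σ u.2) σ⟩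
    left_inv := fun u => Subtype.ext <| by
      change σ • interchange c h (1 / κ) (1 / e) σ (interchange c h' κ e σ u.1) = u.1
      rw [interchange_interchange h h' hκ he hσ hs, smul_smul, hσσ, one_smul]
    right_inv := fun u => Subtype.ext <| by
      have h1 := interchange_interchange h' h (one_div_ne_zero hκ) (one_div_ne_zero he) hσ
        (hs.trans (starSign_comm s h' h)) u.1
      rw [one_div_one_div, one_div_one_div] at h1
      change interchangeHom c h' κ e σ (σ • interchangeHom c h (1 / κ) (1 / e) σ u.1) = u.1
      rw [map_zsmul]
      change σ • interchange c h' κ e σ (interchange c h (1 / κ) (1 / e) σ u.1) = u.1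
      rw [h1, smul_smul, hσσ, one_smul]
    map_add' := fun u v => Subtype.ext (map_add (interchangeHom c h' κ e σ) u.1 v.1) }

/-- Abelian duality for the presheaves of cochain complexes. -/
def complexPresheafIso (hκ : κ ≠ 0) (he : e ≠ 0) (hσ : σ = 1 ∨ σ = -1)
    (hs : (σ : ℝ) = starSign s h h') :
    complexPresheaf s p q h κ e ≅ complexPresheaf s q p h' (1 / κ) (1 / e) :=
  NatIso.ofComponents
    (fun c => HomologicalComplex.Hom.isoOfComponents
      (fun i => (interchangeEquiv h h' c.unop hκ he hσ hs i).toAddCommGrpIso)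
      (fun i j hij => by
        obtain rfl : i + 1 = j := hij
        dsimp only [complexPresheaf, complexAt]
        rw [CochainComplex.of_d, CochainComplex.of_d]
        refine AddCommGrpCat.hom_ext (AddMonoidHom.ext fun u => Subtype.ext ?_)
        exact (interchange_fieldsD h h' hκ he hσ hs u.1).symm))
    (fun f => by
      refine HomologicalComplex.hom_ext _ _ fun i => AddCommGrpCat.hom_ext
        (AddMonoidHom.ext fun u => Subtype.ext ?_)
      exact interchange_fieldsPull h' κ e σ f.unop u.1)

/-- Abelian duality for the presheaves of cochain complexes, with the degree `p'` of the dual of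
the dual theory only propositionally equal to `p`. -/
theorem exists_complexPresheaf_iso {p' : ℕ} (hp' : p' = p) (h'' : n = (p' + 1) + (q + 1))
    (hκ : κ ≠ 0) (he : e ≠ 0) : ∃ σ : ℤ, (σ = 1 ∨ σ = -1) ∧
      ∃ Φ : complexPresheaf s p q h κ e ≅ complexPresheaf s q p' h'' (1 / κ) (1 / e),
        ∀ (c : (TestedSpacetime s n)ᵒᵖ) (i : ℤ) (u : fieldsGr c.unop p q i),
          (show fieldsGr c.unop q p' i from ((Φ.hom.app c).f i).hom u).1 =
            interchange c.unop h'' κ e σ u.1 := by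
  subst hp'
  obtain ⟨σ, hσ, hs⟩ := exists_int_eq_starSign s h h''
  exact ⟨σ, hσ, complexPresheafIso h h'' hκ he hσ hs, fun c i u => rfl⟩

end Duality

end AbelianDuality

end

theorem mainTheorem1 (s : AbelianDuality.SpacetimeKind) (n p : ℕ) (hp : p + 2 ≤ n) (κ e : ℝ)
    (hκ : κ ≠ 0) (he : e ≠ 0) :
    Nonempty (AbelianDuality.stackOf (AbelianDuality.MxwCirc s p n hp κ e) ≅
      AbelianDuality.stackOf
        (AbelianDuality.MxwCirc s (n - p - 2) n (by omega) (1 / κ) (1 / e))) ∧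
    Nonempty (AbelianDuality.abStackOf (AbelianDuality.MxwCirc s p n hp κ e) ≅
      AbelianDuality.abStackOf
        (AbelianDuality.MxwCirc s (n - p - 2) n (by omega) (1 / κ) (1 / e))) ∧
    ∃ σ : ℤ, (σ = 1 ∨ σ = -1) ∧
      ∃ Φ : AbelianDuality.MxwCirc s p n hp κ e ≅
          AbelianDuality.MxwCirc s (n - p - 2) n (by omega) (1 / κ) (1 / e),
        ∀ (c : (AbelianDuality.TestedSpacetime s n)ᵒᵖ) (i : ℤ)
          (u : ((AbelianDuality.MxwCirc s p n hp κ e).obj c).X i),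
          AbelianDuality.MxwCirc.val (((Φ.hom.app c).f i).hom u) =
            AbelianDuality.interchange c.unop (by omega) κ e σ (AbelianDuality.MxwCirc.val u) := by
  obtain ⟨σ, hσ, Φ, hΦ⟩ := AbelianDuality.exists_complexPresheaf_iso (s := s) (n := n) (p := p)
    (q := n - p - 2) (p' := n - (n - p - 2) - 2) (by omega) (by omega) (by omega) hκ he
  exact ⟨⟨(AbelianDuality.stackEquivalences s n).Q.mapIso
      (Functor.isoWhiskerRight Φ (AbelianDuality.toSimplicialAb ⋙ AbelianDuality.forgetSAb))⟩,
    ⟨(AbelianDuality.abStackEquivalences s n).Q.mapIso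
      (Functor.isoWhiskerRight Φ AbelianDuality.toSimplicialAb)⟩, σ, hσ, Φ, hΦ⟩
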